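/- **Setting.** Let $\varphi^D(z)=\sum_{m\in\mathbb Z}\varphi_{-m-\frac12}z^m$ be the neutral fermion field, whose modes $\varphi_r$ ($r\in\mathbb Z+\frac12$) satisfy $\{\varphi_r,\varphi_s\}=\delta_{r,-s}$, and let $F^{\otimes\frac12}$ be its Fock space over $\mathbb C$: $\varphi_r|0\rangle=0$ for $r>0$, and the monomials $\varphi_{-n_k-\frac12}\cdots\varphi_{-n_1-\frac12}|0\rangle$ with $n_k>\dots>n_1\ge 0$ form a basis. For $m\in\mathbb Z$ let $F_{(m)}\subset F^{\otimes\frac12}$ be the span of those monomials with $\#\{i: n_i \text{ odd}\}-\#\{i: n_i\text{ even}\}=m$. Let $F^{\otimes1}$ be the Fock space over $\mathbb C$ of the charged fermions $\psi^\pm(z)=\sum_{n\in\mathbb Z}\psi^\pm_nz^{-n-1}$, with $\{\psi^+_m,\psi^-_n\}=\delta_{m+n,-1}$, $\{\psi^\pm_m,\psi^\pm_n\}=0$, $\psi^\pm_n|0\rangle=0$ for $n\ge0$. For odd fields put $:a(z)b(w):\;=a(z)_+b(w)-b(w)a(z)_-$, where $a(z)_+$ (respectively $a(z)_-$) is the part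 of $a(z)$ with nonnegative (respectively negative) powers of $z$, and obtain $:a(z)b(z):$ by setting $w=z$. Write $\partial_{z^2}=\frac1{2z}\partial_z$. Let $\mathcal D$ be the Lie algebra of differential operators on the circle, i.e. of the operators $\sum_j a_j(t)\partial_t^j$ (finite sums, $a_j\in\mathbb C[t,t^{-1}]$) with the commutator bracket, with basis $J^k_n=t^{n+k}(-\partial_t)^k$ ($k\in\mathbb Z_{\ge0}$, $n\in\mathbb Z$), and let $\widehat{\mathcal D}=W_{1+\infty}=\mathcal D\oplus\mathbb CC$ be its universal central extension, with bracket $[A+aC,B+bC]=[A,B]+\Psi(A,B)C$, where $\Psi$ is the bilinear antisymmetric form with $$\Psi\bigl(t^rf(t\partial_t),t^sg(t\partial_t)\bigr)=\delta_{r+s,0}\sum_{-r\le j\le -1}f(j)\,g(j+r)\qquad (r\ge0)$$ for polynomials $f,g$. Write $J^k_n$ also for the element $J^k_n+0\cdot C$ of $\widehat{\mathcal D}$. **Proposition.** 1. For every $k\ge0$ the field $\frac{(-1)^k}{4z}:\bigl(\varphi^D(z)-\varphi^D(-z)\bigr)\,\partial_{z^2}^k\bigl(\varphi^D(z)+\varphi^D(-z)\bigr):$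 contains only even powers of $z$, and the assignment $$J^k(z^2)=\sum_{n\in\mathbb Z}J^k_n z^{-2k-2n-2}\;\longmapsto\;\frac{(-1)^k}{4z}:\bigl(\varphi^D(z)-\varphi^D(-z)\bigr)\,\partial_{z^2}^k\bigl(\varphi^D(z)+\varphi^D(-z)\bigr):\qquad(k\ge0)$$ extends to a unique representation of the Lie algebra $\widehat{\mathcal D}=W_{1+\infty}$ on $F^{\otimes\frac12}$; in it $C$ acts as the identity. 2. $F^{\otimes\frac12}=\bigoplus_{m\in\mathbb Z}F_{(m)}$, and each $F_{(m)}$ is a $\widehat{\mathcal D}$-submodule, irreducible under this action. 3. The assignment $\sum_{n\in\mathbb Z}J^k_nz^{-n-k-1}\longmapsto(-1)^k:\psi^+(z)\partial_z^k\psi^-(z):$ ($k\ge0$) gives a representation of $\widehat{\mathcal D}$ on $F^{\otimes1}$, and $$F^{\otimes1}\;\cong\;F^{\otimes\frac12}=\bigoplus_{m\in\mathbb Z}F_{(m)}$$ as $\widehat{\mathcal D}$-modules. -/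

import Mathlib

open scoped LaurentPolynomial Polynomial

attribute [local instance 100] LieRing.ofAssociativeRing

noncomputable section


/-! ### Fermionic Fock spaces -/

/-- The fermionic Fock space with one creation operator for every element of a linearly ordered
index set: the complex vector space with basis `e_S`, for `S` a finite set of indices. The basis
vector of `S = {i₁ < i₂ < ⋯ < iₖ}` is the monomial `c_{iₖ} ⋯ c_{i₂} c_{i₁} |0⟩`. -/
abbrev Fock (ι : Type) : Type := Finset ι →₀ ℂ

namespace Fock

variable {ι : Type} [LinearOrder ι]

/-- The monomial basis vector `e_S`. -/
def mono (S : Finset ι) : Fock ι := Finsupp.single S 1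

/-- The vacuum vector `|0⟩`. -/
def vac : Fock ι := mono ∅

/-- The sign picked up when an operator is moved to the position of index `i` in the monomial of
`S`, past the factors of larger index. -/
def sgn (S : Finset ι) (i : ι) : ℂ := (-1) ^ (S.filter (fun j => i < j)).card

/-- The creation operator with index `i`: left multiplication by `c_i`. -/
def create (i : ι) : Module.End ℂ (Fock ι) :=
  Finsupp.linearCombination ℂ fun S => if i ∈ S then 0 else sgn S i • mono (insert i S)

/-- The annihilation operator with index `i`, dual to the creation operator with index `i`. -/
def annih (i : ι) : Module.End ℂ (Fock ι) :=
  Finsupp.linearCombination ℂ fun S => if i ∈ S then sgn S i • mono (S.erase i) else 0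

theorem create_mono (i : ι) (S : Finset ι) :
    create i (mono S) = if i ∈ S then 0 else sgn S i • mono (insert i S) := by
  simp [create, mono]

theorem annih_mono (i : ι) (S : Finset ι) :
    annih i (mono S) = if i ∈ S then sgn S i • mono (S.erase i) else 0 := by
  simp [annih, mono]

theorem end_ext {A B : Module.End ℂ (Fock ι)} (h : ∀ S, A (mono S) = B (mono S)) : A = B := by
  refine Finsupp.lhom_ext fun S c => ?_
  have : Finsupp.single S c = c • mono S := by simp [mono]
  rw [this, map_smul, map_smul, h]

theorem sgn_mul_self (S : Finset ι) (i : ι) : sgn S i * sgn S i = 1 := by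
  rw [sgn, ← pow_add]; exact Even.neg_one_pow ⟨_, rfl⟩

theorem sgn_insert {S : Finset ι} {i j : ι} (hj : j ∉ S) :
    sgn (insert j S) i = (if i < j then -1 else 1) * sgn S i := by
  unfold sgn
  rw [Finset.filter_insert]
  split_ifs with h
  · rw [Finset.card_insert_of_notMem (by simp [hj]), pow_succ]; ring
  · ring

theorem sgn_erase {S : Finset ι} {i j : ι} (hj : j ∈ S) :
    sgn (S.erase j) i = (if i < j then -1 else 1) * sgn S i := by
  conv_rhs => rw [← Finset.insert_erase hj]
  rw [sgn_insert (Finset.notMem_erase j S), ← mul_assoc]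
  split_ifs <;> ring

/-- Creation operators anticommute. -/
theorem create_create (i j : ι) : create i * create j + create j * create i = 0 := by
  refine end_ext fun S => ?_
  by_cases hij : i = j
  · subst hij
    by_cases hi : i ∈ S <;> simp [create_mono, hi]
  · by_cases hi : i ∈ S <;> by_cases hj : j ∈ S <;>
      simp [create_mono, hi, hj, hij, Ne.symm hij, sgn_insert, smul_smul, Finset.insert_comm i j]
    rcases lt_or_gt_of_ne hij with h | h <;> simp [h, h.not_gt, mul_comm (sgn S i)]

/-- Annihilation operators anticommute. -/
theorem annih_annih (i j : ι) : annih i * annih j + annih j * annih i = 0 := by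
  refine end_ext fun S => ?_
  by_cases hij : i = j
  · subst hij
    by_cases hi : i ∈ S <;> simp [annih_mono, hi]
  · by_cases hi : i ∈ S <;> by_cases hj : j ∈ S <;>
      simp [annih_mono, hi, hj, hij, Ne.symm hij, sgn_erase, smul_smul,
        Finset.erase_right_comm (a := i) (b := j)]
    rcases lt_or_gt_of_ne hij with h | h <;> simp [h, h.not_gt, mul_comm (sgn S i)]

/-- The anticommutator of an annihilation and a creation operator. -/
theorem annih_create (i j : ι) :
    annih i * create j + create j * annih i = if i = j then 1 else 0 := by
  refine end_ext fun S => ?_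
  by_cases hij : i = j
  · subst hij
    by_cases hi : i ∈ S
    · simp [annih_mono, create_mono, hi, smul_smul, sgn_erase, sgn_mul_self]
    · simp [annih_mono, create_mono, hi, smul_smul, sgn_insert, sgn_mul_self]
  · by_cases hi : i ∈ S <;> by_cases hj : j ∈ S <;>
      simp [annih_mono, create_mono, hi, hj, hij, Ne.symm hij, smul_smul, sgn_insert, sgn_erase]
    rw [Finset.erase_insert_of_ne (Ne.symm hij)]
    rcases lt_or_gt_of_ne hij with h | h <;> simp [h, h.not_gt, mul_comm (sgn S i)]

/-- Annihilation operators kill the vacuum. -/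
theorem annih_vac (i : ι) : annih i (vac : Fock ι) = 0 := by
  simp [vac, annih_mono]

/-- The vacuum generates the Fock space under the creation operators. -/
theorem eq_top_of_vac_mem (W : Submodule ℂ (Fock ι)) (h0 : vac ∈ W)
    (h : ∀ i, ∀ v ∈ W, create i v ∈ W) : W = ⊤ := by
  have key : ∀ S : Finset ι, mono S ∈ W := by
    intro S
    induction S using Finset.induction_on_max with
    | empty => exact h0
    | insert a S hlt ih =>
      have ha : a ∉ S := fun ha => lt_irrefl _ (hlt a ha)
      have : create a (mono S) = mono (insert a S) := by
        have hs : S.filter (fun j => a < j) = ∅ := by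
          refine Finset.filter_eq_empty_iff.2 fun j hj => (hlt j hj).not_gt
        simp [create_mono, ha, sgn, hs]
      exact this ▸ h a _ ih
  rw [eq_top_iff]
  intro v _
  have hv : v = v.sum fun S c => c • mono S := by
    conv_lhs => rw [← Finsupp.sum_single v]
    simp [mono]
  rw [hv]
  exact Submodule.sum_mem _ fun S _ => W.smul_mem _ (key S)

/-- A vector involves only finitely many indices. -/
theorem finite_annih (v : Fock ι) : {i | annih i v ≠ 0}.Finite := by
  refine Set.Finite.subset (v.support.biUnion id).finite_toSet fun i hi => ?_
  by_contra hc
  refine hi ?_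
  rw [annih, Finsupp.linearCombination_apply]
  refine Finset.sum_eq_zero fun S hS => ?_
  have : i ∉ S := fun h => hc (by
    simp only [Finset.coe_biUnion, Set.mem_iUnion]
    exact ⟨S, hS, h⟩)
  simp [this]

end Fock

/-! ### Fields and operations on fields -/

namespace FormalField

open HVertexOperator

variable {V : Type} [AddCommGroup V] [Module ℂ V]

theorem exists_bound (a : VertexOperator ℂ V) (v : V) : ∃ N : ℤ, ∀ m < N, coeff a m v = 0 :=
  ⟨_, fun _ h => VertexOperator.coeff_eq_zero_of_lt_order a _ v h⟩

theorem bddBelow_of_bound {V : Type} [AddCommGroup V] {f : ℤ → V} (h : ∃ N : ℤ, ∀ m < N, f m = 0) :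
    BddBelow (Function.support f) := by
  obtain ⟨N, hN⟩ := h
  exact ⟨N, fun m hm => not_lt.1 fun hlt => hm (hN m hlt)⟩

/-- The field `a(-z)`. -/
def reflect (a : VertexOperator ℂ V) : VertexOperator ℂ V :=
  VertexOperator.of_coeff (fun m => ((-1 : ℂ) ^ m) • coeff a m) fun v =>
    bddBelow_of_bound <| (exists_bound a v).imp fun N hN m hm => by
      rw [LinearMap.smul_apply, hN m hm, smul_zero]

/-- The field `z ^ k * a(z)`. -/
def mulZ (k : ℤ) (a : VertexOperator ℂ V) : VertexOperator ℂ V :=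
  VertexOperator.of_coeff (fun m => coeff a (m - k)) fun v =>
    bddBelow_of_bound <| (exists_bound a v).elim fun N hN =>
      ⟨N + k, fun m hm => hN _ (by lia)⟩

/-- The derivative `∂_z a(z)`. -/
def derivZ (a : VertexOperator ℂ V) : VertexOperator ℂ V :=
  VertexOperator.of_coeff (fun m => ((m : ℂ) + 1) • coeff a (m + 1)) fun v =>
    bddBelow_of_bound <| (exists_bound a v).elim fun N hN =>
      ⟨N - 1, fun m hm => by rw [LinearMap.smul_apply, hN _ (by lia), smul_zero]⟩

/-- The derivative with respect to `z ^ 2`, that is `(2 z)⁻¹ ∂_z a(z)`. -/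
def derivZSq (a : VertexOperator ℂ V) : VertexOperator ℂ V :=
  (1 / 2 : ℂ) • mulZ (-1) (derivZ a)

/-- The coefficient of `z ^ i * w ^ j` in the normal ordered product of two odd fields
`:a(z) b(w): = a(z)₊ b(w) - b(w) a(z)₋`, where `a(z)₊` collects the nonnegative and `a(z)₋` the
negative powers of `z` in `a(z)`. -/
def normalOrdCoeff (a b : VertexOperator ℂ V) (i j : ℤ) : Module.End ℂ V :=
  if 0 ≤ i then coeff a i * coeff b j else -(coeff b j * coeff a i)

theorem normalOrd_bound (a b : VertexOperator ℂ V) (v : V) :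
    ∃ N : ℤ, ∀ m < N, ∀ i, normalOrdCoeff a b i (m - i) v = 0 := by
  obtain ⟨Na, ha⟩ := exists_bound a v
  obtain ⟨Nb, hb⟩ := exists_bound b v
  choose Nc hc using fun i : ℤ => exists_bound b (coeff a i v)
  obtain ⟨K, hK⟩ := ((Set.finite_Ico Na 0).image fun i => Nc i + i).bddBelow
  refine ⟨min Nb K, fun m hm i => ?_⟩
  unfold normalOrdCoeff
  split_ifs with hi
  · rw [Module.End.mul_apply, hb _ (by lia), map_zero]
  · rw [LinearMap.neg_apply, Module.End.mul_apply]
    by_cases hia : i < Na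
    · rw [ha i hia, map_zero, neg_zero]
    · have : K ≤ Nc i + i := hK ⟨i, ⟨not_lt.1 hia, not_le.1 hi⟩, rfl⟩
      rw [hc i _ (by lia), neg_zero]

theorem normalOrd_finite (a b : VertexOperator ℂ V) (m : ℤ) (v : V) :
    (Function.support fun i => normalOrdCoeff a b i (m - i) v).Finite := by
  obtain ⟨Na, ha⟩ := exists_bound a v
  obtain ⟨Nb, hb⟩ := exists_bound b v
  refine (Set.finite_Icc (min Na 0) (m - Nb)).union (Set.finite_Ico Na 0) |>.subset
    fun i hi => ?_
  by_contra hc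
  simp only [Set.mem_union, Set.mem_Icc, Set.mem_Ico, not_or, not_and, not_le, not_lt] at hc
  refine hi ?_
  change normalOrdCoeff a b i (m - i) v = 0
  unfold normalOrdCoeff
  split_ifs with h
  · rw [Module.End.mul_apply, hb _ (by have := hc.1 (by lia); lia), map_zero]
  · rw [LinearMap.neg_apply, Module.End.mul_apply, ha i (by
      by_contra h'
      exact h (hc.2 (not_lt.1 h'))), map_zero, neg_zero]

/-- The normal ordered product `:a(z) b(z):` of two odd fields. The coefficient of `z ^ m`, applied
to a vector, is the sum (which has only finitely many nonzero terms) over all `i + j = m` of the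
coefficients of `z ^ i * w ^ j` in `:a(z) b(w):`. -/
def normalOrd (a b : VertexOperator ℂ V) : VertexOperator ℂ V :=
  VertexOperator.of_coeff
    (fun m =>
      { toFun := fun v => ∑ᶠ i : ℤ, normalOrdCoeff a b i (m - i) v
        map_add' := fun u v => by
          simp only [map_add]
          exact finsum_add_distrib (normalOrd_finite a b m u) (normalOrd_finite a b m v)
        map_smul' := fun c v => by
          simp only [map_smul, RingHom.id_apply]
          exact (smul_finsum' c (normalOrd_finite a b m v)).symm })
    fun v => bddBelow_of_bound <| (normalOrd_bound a b v).imp fun N hN m hm => by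
      simp [hN m hm]

theorem coeff_normalOrd (a b : VertexOperator ℂ V) (m : ℤ) (v : V) :
    coeff (normalOrd a b) m v = ∑ᶠ i : ℤ, normalOrdCoeff a b i (m - i) v := rfl

end FormalField

/-! ### The neutral fermion -/

open Fock FormalField HVertexOperator

/-- The Fock space `F^{⊗ 1/2}` of a single neutral fermion: the creation operator with index
`n : ℕ` is the mode `φ_{-n-1/2}`, the annihilation operator with index `n` is `φ_{n+1/2}`. -/
abbrev FockD : Type := Fock ℕ

/-- The coefficient `φ_{-m-1/2}` of `z ^ m` in the neutral fermion field. -/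
def phiCoeff (m : ℤ) : Module.End ℂ FockD :=
  if 0 ≤ m then create m.toNat else annih (-m - 1).toNat

/-- The defining relation `{φ_r, φ_s} = δ_{r,-s}` with `r = -m - 1/2` and `s = -n - 1/2`. -/
theorem phiCoeff_anticomm (m n : ℤ) :
    phiCoeff m * phiCoeff n + phiCoeff n * phiCoeff m = if m + n = -1 then 1 else 0 := by
  unfold phiCoeff
  split_ifs with hm hn h hn h h
  · lia
  · exact create_create _ _
  · rw [add_comm, annih_create, if_pos (by lia)]
  · rw [add_comm, annih_create, if_neg (by lia)]
  all_goals first | lia | skip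
  · rw [annih_create, if_pos (by lia)]
  · rw [annih_create, if_neg (by lia)]
  · exact annih_annih _ _

theorem phiCoeff_vac (m : ℤ) (hm : m < 0) : phiCoeff m vac = 0 := by
  rw [phiCoeff, if_neg (by lia), annih_vac]

theorem exists_annih_bound (v : FockD) : ∃ N : ℤ, ∀ m < N, phiCoeff m v = 0 := by
  obtain ⟨K, hK⟩ := (finite_annih v).bddAbove
  refine ⟨-K - 1, fun m hm => ?_⟩
  rw [phiCoeff, if_neg (by lia)]
  by_contra h
  have := hK h
  lia

/-- The neutral fermion field `φ^D(z) = ∑ φ_{-m-1/2} z ^ m`. -/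
def phiD : VertexOperator ℂ FockD :=
  VertexOperator.of_coeff phiCoeff fun v => bddBelow_of_bound (exists_annih_bound v)

/-- The degree `dg` of a monomial: the number of odd minus the number of even indices. -/
def dg (S : Finset ℕ) : ℤ :=
  ((S.filter (fun n => Odd n)).card : ℤ) - ((S.filter (fun n => Even n)).card : ℤ)

/-- The component `F_(m)`, spanned by the monomials of degree `m`. -/
def component (m : ℤ) : Submodule ℂ FockD :=
  Submodule.span ℂ (mono '' {S : Finset ℕ | dg S = m})

/-- The field `((-1)^k / (4 z)) :(φ(z) - φ(-z)) ∂_{z²}^k (φ(z) + φ(-z)):`. -/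
def currentD (k : ℕ) : VertexOperator ℂ FockD :=
  ((-1 : ℂ) ^ k / 4) •
    mulZ (-1) (normalOrd (phiD - reflect phiD) (derivZSq^[k] (phiD + reflect phiD)))

/-! ### The charged fermions -/

/-- The Fock space `F^{⊗ 1}` of a pair of charged fermions. The creation operator with index
`i : ℤ` is `ψ⁺_{-i-1}` if `i ≥ 0` and `ψ⁻_{i}` if `i < 0`; the annihilation operator with index `i`
is correspondingly `ψ⁻_{i}` if `i ≥ 0` and `ψ⁺_{-i-1}` if `i < 0`. -/
abbrev FockA : Type := Fock ℤ

/-- The mode `ψ⁺_n`. -/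
def psiPlusMode (n : ℤ) : Module.End ℂ FockA :=
  if n < 0 then create (-n - 1) else annih (-n - 1)

/-- The mode `ψ⁻_n`. -/
def psiMinusMode (n : ℤ) : Module.End ℂ FockA :=
  if n < 0 then create n else annih n

theorem psi_anticomm (m n : ℤ) :
    psiPlusMode m * psiMinusMode n + psiMinusMode n * psiPlusMode m
      = if m + n = -1 then 1 else 0 := by
  unfold psiPlusMode psiMinusMode
  by_cases hm : m < 0 <;> by_cases hn : n < 0 <;> simp only [hm, hn, if_true, if_false]
  · rw [create_create, if_neg (by lia)]
  · rw [add_comm, annih_create]; exact if_congr (by lia) rfl rfl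
  · rw [annih_create]; exact if_congr (by lia) rfl rfl
  · rw [annih_annih, if_neg (by lia)]

theorem psiPlus_anticomm (m n : ℤ) :
    psiPlusMode m * psiPlusMode n + psiPlusMode n * psiPlusMode m = 0 := by
  unfold psiPlusMode
  by_cases hm : m < 0 <;> by_cases hn : n < 0 <;> simp only [hm, hn, if_true, if_false]
  · exact create_create _ _
  · rw [add_comm, annih_create, if_neg (by lia)]
  · rw [annih_create, if_neg (by lia)]
  · exact annih_annih _ _

theorem psiMinus_anticomm (m n : ℤ) :
    psiMinusMode m * psiMinusMode n + psiMinusMode n * psiMinusMode m = 0 := by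
  unfold psiMinusMode
  by_cases hm : m < 0 <;> by_cases hn : n < 0 <;> simp only [hm, hn, if_true, if_false]
  · exact create_create _ _
  · rw [add_comm, annih_create, if_neg (by lia)]
  · rw [annih_create, if_neg (by lia)]
  · exact annih_annih _ _

theorem psi_vac (n : ℤ) (hn : 0 ≤ n) : psiPlusMode n vac = 0 ∧ psiMinusMode n vac = 0 := by
  simp [psiPlusMode, psiMinusMode, hn.not_gt, annih_vac]

theorem exists_psi_bound (v : FockA) :
    ∃ N : ℤ, ∀ m < N, psiPlusMode (-m - 1) v = 0 ∧ psiMinusMode (-m - 1) v = 0 := by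
  obtain ⟨K, hK⟩ := (finite_annih v).bddAbove
  obtain ⟨K', hK'⟩ := (finite_annih v).bddBelow
  refine ⟨min (min (-K - 1) K') 0, fun m hm => ?_⟩
  rw [psiPlusMode, psiMinusMode, if_neg (by lia), if_neg (by lia)]
  constructor <;> by_contra h
  · have := hK' h
    lia
  · have := hK h
    lia

/-- The charged fermion field `ψ⁺(z) = ∑ ψ⁺_n z ^ (-n-1)`. -/
def psiPlus : VertexOperator ℂ FockA :=
  VertexOperator.of_coeff (fun m => psiPlusMode (-m - 1)) fun v =>
    bddBelow_of_bound ((exists_psi_bound v).imp fun _ h m hm => (h m hm).1)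

/-- The charged fermion field `ψ⁻(z) = ∑ ψ⁻_n z ^ (-n-1)`. -/
def psiMinus : VertexOperator ℂ FockA :=
  VertexOperator.of_coeff (fun m => psiMinusMode (-m - 1)) fun v =>
    bddBelow_of_bound ((exists_psi_bound v).imp fun _ h m hm => (h m hm).2)

/-- The field `(-1)^k :ψ⁺(z) ∂_z^k ψ⁻(z):`. -/
def currentA (k : ℕ) : VertexOperator ℂ FockA :=
  ((-1 : ℂ) ^ k) • normalOrd psiPlus (derivZ^[k] psiMinus)

/-! ### Differential operators on the circle -/

namespace DiffCircle

open LaurentPolynomial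

/-- Multiplication by a Laurent polynomial. -/
def mulOp (a : ℂ[T;T⁻¹]) : Module.End ℂ ℂ[T;T⁻¹] := LinearMap.mulLeft ℂ a

/-- The linear operator with prescribed values on the powers `t ^ j`. -/
def ofValues (g : ℤ → ℂ[T;T⁻¹]) : Module.End ℂ ℂ[T;T⁻¹] where
  toFun p := p.coeff.sum fun j c => c • g j
  map_add' p q := by
    rw [AddMonoidAlgebra.coeff_add, Finsupp.sum_add_index'] <;> simp [add_smul]
  map_smul' c p := by
    rw [AddMonoidAlgebra.coeff_smul, Finsupp.sum_smul_index'] <;>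
      simp [Finsupp.smul_sum, smul_smul]

theorem ofValues_T (g : ℤ → ℂ[T;T⁻¹]) (j : ℤ) : ofValues g (T j) = g j := by
  change (Finsupp.single j (1 : ℂ)).sum (fun j c => c • g j) = g j
  simp

theorem end_ext {A B : Module.End ℂ ℂ[T;T⁻¹]} (h : ∀ j, A (T j) = B (T j)) : A = B := by
  refine LinearMap.ext fun p => ?_
  induction p using LaurentPolynomial.induction_on' with
  | add p q hp hq => rw [map_add, map_add, hp, hq]
  | C_mul_T n a => rw [← smul_eq_C_mul, map_smul, map_smul, h]

/-- The derivation `∂_t`. -/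
def derivT : Module.End ℂ ℂ[T;T⁻¹] := ofValues fun j => (j : ℂ) • T (j - 1)

theorem derivT_T (j : ℤ) : derivT (T j) = (j : ℂ) • T (j - 1) := ofValues_T _ j

/-- The associative algebra of differential operators `∑ a_j(t) ∂_t ^ j` on the circle, with Laurent
polynomial coefficients. -/
def diffAlg : Subalgebra ℂ (Module.End ℂ ℂ[T;T⁻¹]) :=
  Algebra.adjoin ℂ (Set.range mulOp ∪ {derivT})

/-- The Lie algebra `𝒟 = Diff ℂ^*` of differential operators, with the commutator bracket. -/
def diffOp : LieSubalgebra ℂ (Module.End ℂ ℂ[T;T⁻¹]) where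
  toSubmodule := Subalgebra.toSubmodule diffAlg
  lie_mem' := fun hx hy =>
    diffAlg.sub_mem (diffAlg.mul_mem hx hy) (diffAlg.mul_mem hy hx)

theorem mulOp_mem (a : ℂ[T;T⁻¹]) : mulOp a ∈ diffAlg :=
  Algebra.subset_adjoin (Or.inl ⟨a, rfl⟩)

theorem derivT_mem : derivT ∈ diffAlg := Algebra.subset_adjoin (Or.inr rfl)

/-- The differential operator `J^k_n = t ^ (n + k) (-∂_t) ^ k`. -/
def jOp (k : ℕ) (n : ℤ) : diffOp :=
  ⟨mulOp (T (n + k)) * (-derivT) ^ k,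
    diffAlg.mul_mem (mulOp_mem _) (pow_mem (neg_mem derivT_mem) k)⟩

/-- The matrix coefficient of an operator: the coefficient of `t ^ i` in `A t ^ j`. -/
def mat (A : Module.End ℂ ℂ[T;T⁻¹]) (i j : ℤ) : ℂ := (A (T j)).coeff i

theorem mat_ext {A B : Module.End ℂ ℂ[T;T⁻¹]} (h : ∀ i j, mat A i j = mat B i j) : A = B :=
  end_ext fun j => LaurentPolynomial.ext fun i => h i j

/-- The operator `t ^ r f(t ∂_t)`, which maps `t ^ j` to `f(j) t ^ (j + r)`. -/
def homog (r : ℤ) : ℂ[X] →ₗ[ℂ] Module.End ℂ ℂ[T;T⁻¹] where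
  toFun f := ofValues fun j => f.eval (j : ℂ) • T (j + r)
  map_add' f g := end_ext fun j => by simp [ofValues_T, add_smul]
  map_smul' c f := end_ext fun j => by simp [ofValues_T, smul_smul]

theorem homog_T (r : ℤ) (f : ℂ[X]) (j : ℤ) : homog r f (T j) = f.eval (j : ℂ) • T (j + r) :=
  ofValues_T _ j

theorem homog_mul (r s : ℤ) (f g : ℂ[X]) :
    homog r f * homog s g = homog (r + s) (Polynomial.taylor (s : ℂ) f * g) := by
  refine end_ext fun j => ?_
  simp [Polynomial.taylor_eval, Module.End.mul_apply, homog_T, smul_smul, mul_comm, add_assoc, add_comm s r]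

theorem mulOp_T (r : ℤ) : mulOp (T r) = homog r 1 := by
  refine end_ext fun j => ?_
  simp only [mulOp, LinearMap.mulLeft_apply, homog_T, Polynomial.eval_one, one_smul]
  rw [← T_add, add_comm]

theorem derivT_eq : derivT = homog (-1) Polynomial.X := by
  refine end_ext fun j => ?_
  simp [derivT_T, homog_T, sub_eq_add_neg]

theorem homog_mem (r : ℤ) (f : ℂ[X]) : homog r f ∈ diffAlg := by
  have h1 : ∀ r, homog r 1 ∈ diffAlg := fun r => mulOp_T r ▸ mulOp_mem _
  have hX : homog 0 Polynomial.X ∈ diffAlg := by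
    have : homog 0 Polynomial.X = homog 1 1 * derivT := by
      rw [derivT_eq, homog_mul]; simp
    exact this ▸ mul_mem (h1 1) derivT_mem
  have h0 : ∀ f, homog 0 f ∈ diffAlg := by
    intro f
    induction f using Polynomial.induction_on' with
    | add p q hp hq => rw [map_add]; exact add_mem hp hq
    | monomial n a =>
      rw [← mul_one a, ← smul_eq_mul, ← Polynomial.smul_monomial, map_smul]
      refine Subalgebra.smul_mem _ ?_ a
      rw [← Polynomial.X_pow_eq_monomial]
      induction n with
      | zero => exact h1 0
      | succ n ih =>
        have : homog 0 (Polynomial.X ^ (n + 1)) = homog 0 (Polynomial.X ^ n) * homog 0 Polynomial.X := by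
          rw [homog_mul]; simp [pow_succ]
        exact this ▸ mul_mem ih hX
  have : homog r f = homog r 1 * homog 0 f := by rw [homog_mul]; simp
  exact this ▸ mul_mem (h1 r) (h0 f)

/-- The linear map assembling a differential operator from its homogeneous components. -/
def assemble : (ℤ →₀ ℂ[X]) →ₗ[ℂ] Module.End ℂ ℂ[T;T⁻¹] := Finsupp.lsum ℂ homog

theorem assemble_single (r : ℤ) (f : ℂ[X]) : assemble (Finsupp.single r f) = homog r f := by
  simp [assemble]

theorem mat_homog (r : ℤ) (f : ℂ[X]) (i j : ℤ) :
    mat (homog r f) i j = if i = j + r then f.eval (j : ℂ) else 0 := by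
  simp [mat, homog_T, eq_comm]

theorem mat_add (A B : Module.End ℂ ℂ[T;T⁻¹]) (i j : ℤ) :
    mat (A + B) i j = mat A i j + mat B i j := by simp [mat]

theorem mat_smul (c : ℂ) (A : Module.End ℂ ℂ[T;T⁻¹]) (i j : ℤ) :
    mat (c • A) i j = c * mat A i j := by simp [mat]

theorem mat_assemble (F : ℤ →₀ ℂ[X]) (i j : ℤ) :
    mat (assemble F) i j = (F (i - j)).eval (j : ℂ) := by
  induction F using Finsupp.induction_linear with
  | zero => simp [mat]
  | add F G hF hG => simp [mat_add, hF, hG]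
  | single r f =>
    rw [assemble_single, mat_homog, Finsupp.single_apply]
    by_cases h : i = j + r
    · rw [if_pos h, if_pos (by lia)]
    · rw [if_neg h, if_neg (by lia), Polynomial.eval_zero]

theorem assemble_injective : Function.Injective assemble := by
  intro F G h
  ext1 r
  refine Polynomial.eq_of_infinite_eval_eq _ _ ?_
  refine Set.Infinite.mono ?_ (Set.infinite_range_of_injective (Int.cast_injective (α := ℂ)))
  rintro _ ⟨j, rfl⟩
  have := mat_assemble F (j + r) j
  rw [h, mat_assemble] at this
  simpa using this.symm

theorem mem_diffOp_iff (A : Module.End ℂ ℂ[T;T⁻¹]) : A ∈ diffOp ↔ ∃ F, assemble F = A := by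
  constructor
  · intro hA
    have hmul : ∀ F G, ∃ H, assemble H = assemble F * assemble G := by
      intro F G
      induction F using Finsupp.induction_linear with
      | zero => exact ⟨0, by simp⟩
      | add F F' hF hF' =>
        obtain ⟨H, hH⟩ := hF
        obtain ⟨H', hH'⟩ := hF'
        exact ⟨H + H', by rw [map_add, map_add, hH, hH', add_mul]⟩
      | single r f =>
        induction G using Finsupp.induction_linear with
        | zero => exact ⟨0, by simp⟩
        | add F F' hF hF' =>
          obtain ⟨H, hH⟩ := hF
          obtain ⟨H', hH'⟩ := hF'
          exact ⟨H + H', by rw [map_add, map_add, hH, hH', mul_add]⟩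
        | single s g =>
          exact ⟨Finsupp.single (r + s) _, by
            rw [assemble_single, assemble_single, assemble_single, homog_mul]⟩
    change A ∈ Algebra.adjoin ℂ _ at hA
    induction hA using Algebra.adjoin_induction with
    | mem x hx =>
      rcases hx with ⟨a, rfl⟩ | rfl
      · induction a using LaurentPolynomial.induction_on' with
        | add p q hp hq =>
          obtain ⟨H, hH⟩ := hp
          obtain ⟨H', hH'⟩ := hq
          exact ⟨H + H', by rw [map_add, hH, hH']; ext; simp [mulOp, add_mul]⟩
        | C_mul_T n c =>
          refine ⟨c • Finsupp.single n 1, ?_⟩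
          rw [map_smul, assemble_single, ← mulOp_T]
          refine LinearMap.ext fun p => ?_
          change c • (T n * p) = C c * T n * p
          rw [smul_eq_C_mul, mul_assoc]
      · exact ⟨Finsupp.single (-1) Polynomial.X, by rw [assemble_single, derivT_eq]⟩
    | algebraMap c =>
      refine ⟨c • Finsupp.single 0 1, ?_⟩
      rw [map_smul, assemble_single, ← mulOp_T, Algebra.algebraMap_eq_smul_one]
      ext; simp [mulOp]
    | add x y _ _ hx hy =>
      obtain ⟨H, rfl⟩ := hx
      obtain ⟨H', rfl⟩ := hy
      exact ⟨H + H', map_add _ _ _⟩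
    | mul x y _ _ hx hy =>
      obtain ⟨H, rfl⟩ := hx
      obtain ⟨H', rfl⟩ := hy
      exact hmul H H'
  · rintro ⟨F, rfl⟩
    rw [assemble, Finsupp.lsum_apply]
    exact diffOp.toSubmodule.sum_mem fun r _ => homog_mem r _

/-- A differential operator, decomposed into homogeneous components `t ^ r f(t ∂_t)`. -/
def components : (ℤ →₀ ℂ[X]) ≃ₗ[ℂ] diffOp :=
  LinearEquiv.ofBijective (assemble.codRestrict diffOp.toSubmodule fun F =>
      (mem_diffOp_iff _).2 ⟨F, rfl⟩)
    ⟨fun F G h => assemble_injective (congrArg Subtype.val h), fun A => by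
      obtain ⟨F, hF⟩ := (mem_diffOp_iff _).1 A.2
      exact ⟨F, Subtype.ext hF⟩⟩

/-! ### The two-cocycle -/

/-- The indicator function of the nonnegative integers. -/
def chi (i : ℤ) : ℂ := if 0 ≤ i then 1 else 0

/-- The cocycle `Ψ(A, B) = ∑ (A_{ij} B_{ji} - B_{ij} A_{ji})`, summed over `i ≥ 0 > j`; only finitely
many terms are nonzero. -/
def psiFun (A B : Module.End ℂ ℂ[T;T⁻¹]) : ℂ :=
  ∑ᶠ p : ℤ × ℤ, if 0 ≤ p.1 ∧ p.2 < 0 then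
    mat A p.1 p.2 * mat B p.2 p.1 - mat B p.1 p.2 * mat A p.2 p.1 else 0

/-- The matrix of `A` is supported in a band of width `w` around the diagonal. -/
def Banded (w : ℤ) (A : Module.End ℂ ℂ[T;T⁻¹]) : Prop :=
  ∀ i j, w < i - j ∨ w < j - i → mat A i j = 0

theorem exists_banded (A : diffOp) : ∃ w, 0 ≤ w ∧ Banded w A.1 := by
  obtain ⟨F, hF⟩ := (mem_diffOp_iff _).1 A.2
  obtain ⟨w, hw⟩ := (F.support.image fun r => |r|).bddAbove
  refine ⟨max w 0, le_max_right _ _, fun i j h => ?_⟩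
  rw [← hF, mat_assemble]
  by_cases hr : F (i - j) = 0
  · simp [hr]
  · have h1 : |i - j| ≤ w := hw (by
      simp only [Finset.coe_image, Set.mem_image, Finset.mem_coe, Finsupp.mem_support_iff]
      exact ⟨_, hr, rfl⟩)
    have h2 := abs_le.1 h1
    lia

theorem Banded.mono {w w' : ℤ} {A : Module.End ℂ ℂ[T;T⁻¹]} (h : Banded w A) (hw : w ≤ w') :
    Banded w' A := fun i j hij => h i j (by lia)

theorem psiFun_eq {w M : ℤ} {A : Module.End ℂ ℂ[T;T⁻¹]} (B : Module.End ℂ ℂ[T;T⁻¹])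
    (hA : Banded w A) (hM : w ≤ M) :
    psiFun A B = ∑ i ∈ Finset.Icc (-M) M, ∑ j ∈ Finset.Icc (-M) M,
      (chi i - chi j) * mat A i j * mat B j i := by
  have h1 : psiFun A B = ∑ p ∈ Finset.Icc (-M) M ×ˢ Finset.Icc (-M) M,
      if 0 ≤ p.1 ∧ p.2 < 0 then
        mat A p.1 p.2 * mat B p.2 p.1 - mat B p.1 p.2 * mat A p.2 p.1 else 0 := by
    refine finsum_eq_sum_of_support_subset _ ?_
    rintro ⟨i, j⟩ hp
    simp only [Function.mem_support] at hp
    split_ifs at hp with hs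
    · by_contra hc
      simp only [Finset.coe_product, Finset.coe_Icc, Set.mem_prod, Set.mem_Icc, not_and_or,
        not_le] at hc
      refine hp ?_
      rw [hA _ _ (by lia), hA _ _ (by lia)]
      ring
    · exact absurd rfl hp
  rw [h1, Finset.sum_product]
  have h2 : ∀ i j : ℤ, (if 0 ≤ i ∧ j < 0 then
        mat A i j * mat B j i - mat B i j * mat A j i else 0)
      = (if 0 ≤ i ∧ j < 0 then mat A i j * mat B j i else 0)
        - (if 0 ≤ i ∧ j < 0 then mat B i j * mat A j i else 0) := by
    intro i j; split_ifs <;> ring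
  have h3 : ∀ i j : ℤ, (chi i - chi j) * mat A i j * mat B j i
      = (if 0 ≤ i ∧ j < 0 then mat A i j * mat B j i else 0)
        - (if 0 ≤ j ∧ i < 0 then mat B j i * mat A i j else 0) := by
    intro i j
    unfold chi
    by_cases hi : 0 ≤ i <;> by_cases hj : 0 ≤ j <;> simp [hi, hj, not_le.1, not_lt.2]
    all_goals simp [mul_comm]
  simp only [h2, h3, Finset.sum_sub_distrib]
  congr 1
  exact Finset.sum_comm

theorem mat_mul {w M : ℤ} {A B : Module.End ℂ ℂ[T;T⁻¹]} (hA : Banded w A) {i j : ℤ}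
    (hM : i + w ≤ M) (hM' : -M ≤ i - w) :
    mat (A * B) i j = ∑ k ∈ Finset.Icc (-M) M, mat A i k * mat B k j := by
  have key : ∀ p : ℂ[T;T⁻¹], (A p).coeff i = ∑ k ∈ Finset.Icc (-M) M, mat A i k * p.coeff k := by
    intro p
    induction p using LaurentPolynomial.induction_on' with
    | add p q hp hq => simp [hp, hq, mul_add, Finset.sum_add_distrib]
    | C_mul_T n a =>
      have : ∀ k, (C a * T n : ℂ[T;T⁻¹]).coeff k = if n = k then a else 0 := by
        intro k; rw [← smul_eq_C_mul]; simp
      simp only [this, mul_ite, mul_zero, Finset.sum_ite_eq]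
      rw [← smul_eq_C_mul, map_smul]
      change a * mat A i n = _
      split_ifs with h
      · ring
      · rw [hA i n (by
          simp only [Finset.mem_Icc, not_and_or, not_le] at h
          lia), mul_zero]
  exact key (B (T j))

theorem Banded.mul {w w' : ℤ} {A B : Module.End ℂ ℂ[T;T⁻¹]} (hA : Banded w A)
    (hB : Banded w' B) : Banded (w + w') (A * B) := by
  intro i j hij
  rw [mat_mul (M := max (i + w) (w - i)) hA (by lia) (by lia)]
  refine Finset.sum_eq_zero fun k _ => ?_
  by_cases h : w < i - k ∨ w < k - i
  · rw [hA _ _ h, zero_mul]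
  · rw [hB k j (by lia), mul_zero]

theorem psiFun_cyclic {w : ℤ} (hw : 0 ≤ w) {A B D : Module.End ℂ ℂ[T;T⁻¹]} (hA : Banded w A)
    (hB : Banded w B) (hD : Banded w D) :
    psiFun (A * B) D + psiFun (B * D) A + psiFun (D * A) B = 0 := by
  have e : ∀ A B D : Module.End ℂ ℂ[T;T⁻¹], Banded w A → Banded w B → Banded w D →
      psiFun (A * B) D = ∑ i ∈ Finset.Icc (-(4 * w)) (4 * w), ∑ k ∈ Finset.Icc (-(4 * w)) (4 * w),
        ∑ j ∈ Finset.Icc (-(4 * w)) (4 * w),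
        (chi i - chi j) * mat A i k * mat B k j * mat D j i := by
    intro A B D hA hB hD
    rw [psiFun_eq (M := 4 * w) D (hA.mul hB) (by lia)]
    refine Finset.sum_congr rfl fun i hi => ?_
    rw [Finset.sum_comm (s := Finset.Icc (-(4 * w)) (4 * w))]
    refine Finset.sum_congr rfl fun j hj => ?_
    by_cases hs : chi i = chi j
    · simp [hs]
    by_cases hji : w < j - i ∨ w < i - j
    · simp [hD _ _ hji]
    · have hi' : -w ≤ i ∧ i ≤ w := by
        by_contra hc
        refine hs ?_
        unfold chi
        by_cases h0 : 0 ≤ i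
        · rw [if_pos h0, if_pos (by lia)]
        · rw [if_neg h0, if_neg (by lia)]
      rw [mat_mul (M := 4 * w) hA (by lia) (by lia), Finset.mul_sum, Finset.sum_mul]
      exact Finset.sum_congr rfl fun k _ => by ring
  rw [e A B D hA hB hD, e B D A hB hD hA, e D A B hD hA hB]
  set I := Finset.Icc (-(4 * w)) (4 * w)
  have c1 : (∑ i ∈ I, ∑ k ∈ I, ∑ j ∈ I, (chi i - chi j) * mat B i k * mat D k j * mat A j i)
      = ∑ i ∈ I, ∑ k ∈ I, ∑ j ∈ I, (chi k - chi i) * mat B k j * mat D j i * mat A i k := by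
    rw [Finset.sum_comm]
    conv_rhs => rw [Finset.sum_comm]
    rw [Finset.sum_comm]
    refine Finset.sum_congr rfl fun k _ => ?_
    exact Finset.sum_comm
  have c2 : (∑ i ∈ I, ∑ k ∈ I, ∑ j ∈ I, (chi i - chi j) * mat D i k * mat A k j * mat B j i)
      = ∑ i ∈ I, ∑ k ∈ I, ∑ j ∈ I, (chi j - chi k) * mat D j i * mat A i k * mat B k j := by
    rw [Finset.sum_comm]
    refine Finset.sum_congr rfl fun k _ => ?_
    exact Finset.sum_comm
  rw [c1, c2]
  simp only [← Finset.sum_add_distrib]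
  refine Finset.sum_eq_zero fun i _ => Finset.sum_eq_zero fun k _ =>
    Finset.sum_eq_zero fun j _ => by ring

theorem psiFun_swap (A B : Module.End ℂ ℂ[T;T⁻¹]) : psiFun A B = -psiFun B A := by
  unfold psiFun
  rw [← finsum_neg_distrib]
  refine finsum_congr fun p => ?_
  split_ifs <;> ring

theorem psiFun_add_right (A : diffOp) (B B' : Module.End ℂ ℂ[T;T⁻¹]) :
    psiFun A (B + B') = psiFun A B + psiFun A B' := by
  obtain ⟨w, _, hA⟩ := exists_banded A
  simp only [psiFun_eq _ hA le_rfl, mat_add, mul_add, Finset.sum_add_distrib]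

theorem psiFun_smul_right (A : diffOp) (c : ℂ) (B : Module.End ℂ ℂ[T;T⁻¹]) :
    psiFun A (c • B) = c * psiFun A B := by
  obtain ⟨w, _, hA⟩ := exists_banded A
  simp only [psiFun_eq _ hA le_rfl, mat_smul, Finset.mul_sum]
  exact Finset.sum_congr rfl fun i _ => Finset.sum_congr rfl fun j _ => by ring

/-- `Ψ` as a bilinear form on the differential operators. -/
def psiBilin : diffOp →ₗ[ℂ] diffOp →ₗ[ℂ] ℂ :=
  LinearMap.mk₂ ℂ (fun A B => psiFun A B)
    (fun A A' B => by
      rw [psiFun_swap, psiFun_swap A.1, psiFun_swap A'.1, ← neg_add]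
      exact congrArg _ (psiFun_add_right B A.1 A'.1))
    (fun c A B => by
      rw [psiFun_swap, psiFun_swap A.1, smul_neg]
      exact congrArg _ (psiFun_smul_right B c A.1))
    (fun A B B' => psiFun_add_right A B.1 B'.1)
    (fun c A B => psiFun_smul_right A c B.1)

theorem psiBilin_apply (A B : diffOp) : psiBilin A B = psiFun A.1 B.1 := rfl

theorem psiBilin_swap (A B : diffOp) : psiBilin A B = -psiBilin B A := psiFun_swap _ _

theorem psiBilin_jacobi (A B D : diffOp) :
    psiBilin A ⁅B, D⁆ = psiBilin ⁅A, B⁆ D + psiBilin B ⁅A, D⁆ := by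
  obtain ⟨wa, ha0, ha⟩ := exists_banded A
  obtain ⟨wb, hb0, hb⟩ := exists_banded B
  obtain ⟨wd, hd0, hd⟩ := exists_banded D
  have ha' := ha.mono (show wa ≤ wa + wb + wd by lia)
  have hb' := hb.mono (show wb ≤ wa + wb + wd by lia)
  have hd' := hd.mono (show wd ≤ wa + wb + wd by lia)
  have h1 := psiFun_cyclic (by lia) ha' hb' hd'
  have h2 := psiFun_cyclic (by lia) hb' ha' hd'
  have hsub : ∀ X Y Z : diffOp, psiBilin ⁅X, Y⁆ Z
      = psiFun (X.1 * Y.1) Z.1 - psiFun (Y.1 * X.1) Z.1 := by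
    intro X Y Z
    change psiFun (X.1 * Y.1 - Y.1 * X.1) Z.1 = _
    rw [psiFun_swap, psiFun_swap (X.1 * Y.1), psiFun_swap (Y.1 * X.1), sub_eq_add_neg,
      ← neg_one_smul ℂ (Y.1 * X.1), psiFun_add_right, psiFun_smul_right]
    ring
  rw [psiBilin_swap A ⁅B, D⁆, psiBilin_swap B ⁅A, D⁆, hsub, hsub, hsub]
  linear_combination h2 - h1

open LieModule.Cohomology in
/-- `Ψ` as a Lie algebra two-cocycle with trivial coefficients. -/
def psiCocycle : twoCocycle ℂ diffOp (TrivialLieModule ℂ diffOp ℂ) where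
  val := ⟨psiBilin.compr₂ (TrivialLieModule.equiv ℂ diffOp ℂ).symm, fun A => by
    have : psiBilin A A = 0 := self_eq_neg.1 (psiBilin_swap A A)
    simp [this]⟩
  property := by
    rw [mem_twoCocycle_iff_of_trivial]
    intro A B D
    exact psiBilin_jacobi A B D

/-- The value of the cocycle on homogeneous elements `t ^ r f(t ∂_t)` and `t ^ s g(t ∂_t)`. -/
theorem psiFun_homog (r : ℕ) (s : ℤ) (f g : ℂ[X]) :
    psiFun (homog r f) (homog s g) = if (r : ℤ) + s = 0 then
      ∑ j ∈ Finset.Ico (-(r : ℤ)) 0, f.eval (j : ℂ) * g.eval ((j : ℂ) + r) else 0 := by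
  have hb : Banded (r : ℤ) (homog r f) := fun i j h => by
    rw [mat_homog, if_neg]
    lia
  have hval : ∀ p : ℤ × ℤ, (if 0 ≤ p.1 ∧ p.2 < 0 then
      mat (homog r f) p.1 p.2 * mat (homog s g) p.2 p.1
        - mat (homog s g) p.1 p.2 * mat (homog r f) p.2 p.1 else 0) =
      if p.1 = p.2 + r ∧ (r : ℤ) + s = 0 ∧ p.2 ∈ Finset.Ico (-(r : ℤ)) 0 then
        f.eval (p.2 : ℂ) * g.eval ((p.2 : ℂ) + r) else 0 := by
    rintro ⟨i, j⟩
    simp only [mat_homog, Finset.mem_Ico]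
    by_cases h : i = j + r ∧ (r : ℤ) + s = 0 ∧ (-(r : ℤ) ≤ j ∧ j < 0)
    · obtain ⟨h1, h2, h3, h4⟩ := h
      have h5 : (if j = i + (r : ℤ) then f.eval (i : ℂ) else 0) = 0 := if_neg (by lia)
      rw [if_pos (⟨by lia, h4⟩ : 0 ≤ i ∧ j < 0), if_pos h1, if_pos (by lia : j = i + s),
        if_pos (⟨h1, h2, h3, h4⟩ : i = j + r ∧ (r : ℤ) + s = 0 ∧ (-(r : ℤ) ≤ j ∧ j < 0)), h5, h1]
      push_cast
      ring
    · rw [if_neg h]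
      split_ifs <;> first | lia | simp
  rw [psiFun, finsum_congr hval]
  split_ifs with hrs
  · rw [finsum_eq_sum_of_support_subset (s := (Finset.Ico (-(r : ℤ)) 0).image fun j : ℤ => (j + (r : ℤ), j))]
    · rw [Finset.sum_image (by intro a _ b _ h; exact congrArg Prod.snd h)]
      refine Finset.sum_congr rfl fun j hj => ?_
      rw [if_pos ⟨rfl, hrs, hj⟩]
    · rintro ⟨i, j⟩ hp
      simp only [Function.mem_support] at hp
      split_ifs at hp with h
      · simp only [Finset.coe_image, Set.mem_image]
        exact ⟨j, h.2.2, by rw [h.1]⟩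
      · exact absurd rfl hp
  · simp [hrs]

end DiffCircle

/-- The Lie algebra `𝒟̂ = W_{1+∞}`: the central extension `𝒟 ⊕ ℂ C` of `𝒟` with bracket
`[A + a C, B + b C] = [A, B] + Ψ(A, B) C`. -/
abbrev DHat : Type := LieAlgebra.ofTwoCocycle DiffCircle.psiCocycle

namespace DHat

open DiffCircle

/-- The projection onto `𝒟`. -/
def proj : DHat →ₗ⁅ℂ⁆ diffOp where
  toFun x := x.carrier.1
  map_add' _ _ := rfl
  map_smul' _ _ := rfl
  map_lie' := rfl

/-- The element of `𝒟̂ = 𝒟 ⊕ ℂ C` corresponding to a differential operator. -/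
def lift : diffOp →ₗ[ℂ] DHat where
  toFun A := ⟨(A, 0)⟩
  map_add' _ _ := congrArg LieAlgebra.ofTwoCocycle.mk
    (Prod.ext rfl (add_zero (0 : TrivialLieModule ℂ diffOp ℂ)).symm)
  map_smul' c _ := congrArg LieAlgebra.ofTwoCocycle.mk
    (Prod.ext rfl (smul_zero (A := TrivialLieModule ℂ diffOp ℂ) c).symm)

/-- The central element `C`. -/
def central : DHat := ⟨(0, (1 : ℂ))⟩

/-- The element `J^k_n` of `𝒟̂`. -/
def J (k : ℕ) (n : ℤ) : DHat := lift (jOp k n)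

theorem mk_eq (A : diffOp) (c : ℂ) : (⟨(A, c)⟩ : DHat) = lift A + c • central := by
  refine congrArg LieAlgebra.ofTwoCocycle.mk (Prod.ext ?_ ?_)
  · change A = A + c • 0
    rw [smul_zero, add_zero]
  · change c = 0 + c • (1 : ℂ)
    simp

theorem lie_mk (A B : diffOp) (a b : ℂ) :
    ⁅(⟨(A, a)⟩ : DHat), (⟨(B, b)⟩ : DHat)⁆ = ⟨(⁅A, B⁆, psiFun A B)⟩ := by
  refine congrArg LieAlgebra.ofTwoCocycle.mk (Prod.ext rfl ?_)
  change psiFun A B + 0 - 0 = psiFun A B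
  ring

theorem lie_lift (A B : diffOp) : ⁅lift A, lift B⁆ = lift ⁅A, B⁆ + psiFun A B • central := by
  rw [← mk_eq]; exact lie_mk A B 0 0

end DHat

/-! ### The central extension is universal -/

/-- A homomorphism of Lie algebras is a central extension if it is surjective with central
kernel. -/
def IsCentralExtension {E L : Type*} [LieRing E] [LieAlgebra ℂ E] [LieRing L] [LieAlgebra ℂ L]
    (p : E →ₗ⁅ℂ⁆ L) : Prop :=
  Function.Surjective p ∧ ∀ x : E, p x = 0 → ∀ y : E, ⁅x, y⁆ = 0

/-- A central extension is universal if it maps uniquely to every other central extension. -/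
def IsUniversalCentralExtension.{u, v, w} {E : Type u} {L : Type v} [LieRing E] [LieAlgebra ℂ E]
    [LieRing L] [LieAlgebra ℂ L] (p : E →ₗ⁅ℂ⁆ L) : Prop :=
  IsCentralExtension p ∧
    ∀ (E' : Type w) [LieRing E'] [LieAlgebra ℂ E'] (q : E' →ₗ⁅ℂ⁆ L), IsCentralExtension q →
      ∃! f : E →ₗ⁅ℂ⁆ E', ∀ x, q (f x) = p x

namespace DiffCircle

open Polynomial (taylor)

/-- The homogeneous differential operator `t ^ r f(t ∂_t)`. -/
def hom (r : ℤ) : ℂ[X] →ₗ[ℂ] diffOp :=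
  (homog r).codRestrict diffOp.toSubmodule (homog_mem r)

theorem lie_hom (r s : ℤ) (f g : ℂ[X]) :
    ⁅hom r f, hom s g⁆ = hom (r + s) (taylor (s : ℂ) f * g - f * taylor (r : ℂ) g) := by
  refine Subtype.ext ?_
  change homog r f * homog s g - homog s g * homog r f = homog (r + s) _
  rw [homog_mul, homog_mul, add_comm s r, ← map_sub, mul_comm f]

theorem components_single (r : ℤ) (f : ℂ[X]) : components (Finsupp.single r f) = hom r f :=
  Subtype.ext (assemble_single r f)

theorem diffOp_induction {P : diffOp → Prop} (h0 : P 0) (hadd : ∀ A B, P A → P B → P (A + B))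
    (hhom : ∀ r f, P (hom r f)) (A : diffOp) : P A := by
  obtain ⟨F, rfl⟩ := components.surjective A
  induction F using Finsupp.induction_linear with
  | zero => simpa using h0
  | add F G hF hG => rw [map_add]; exact hadd _ _ hF hG
  | single r f => rw [components_single]; exact hhom r f

/-- The difference operator `f(x) ↦ f(x) - f(x + a)`. -/
def diff (a : ℂ) : ℂ[X] →ₗ[ℂ] ℂ[X] := LinearMap.id - taylor a

theorem diff_apply (a : ℂ) (f : ℂ[X]) : diff a f = f - taylor a f := rfl

theorem degree_diff_le (a : ℂ) (f : ℂ[X]) : (diff a f).degree ≤ f.degree := by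
  rw [diff_apply]
  exact (Polynomial.degree_sub_le _ _).trans (by simp)

theorem degree_diff_lt (a : ℂ) {f : ℂ[X]} (hf : f ≠ 0) : (diff a f).degree < f.degree := by
  rw [diff_apply]
  exact Polynomial.degree_sub_lt_left (by simp) hf (by simp)

theorem diff_one_surjective : Function.Surjective (diff 1) := by
  intro f
  induction f using Polynomial.induction_on' with
  | add p q hp hq =>
    obtain ⟨P, rfl⟩ := hp
    obtain ⟨Q, rfl⟩ := hq
    exact ⟨P + Q, map_add _ _ _⟩
  | monomial n a =>
    set b : ℂ[X] := (Polynomial.bernoulli (n + 1)).map (algebraMap ℚ ℂ) with hb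
    have h : diff 1 b = -((n : ℂ) + 1) • Polynomial.monomial n 1 := by
      have h1 := congrArg (Polynomial.map (algebraMap ℚ ℂ)) (Polynomial.bernoulli_comp_one_add_X (n + 1))
      rw [Polynomial.map_comp] at h1
      have h2 : taylor 1 b = b + ((n : ℂ) + 1) • Polynomial.monomial n 1 := by
        rw [Polynomial.taylor_apply, hb]
        simp only [Polynomial.map_add, Polynomial.map_one, Polynomial.map_X] at h1
        rw [Polynomial.C_1, add_comm Polynomial.X, h1, ← Polynomial.X_pow_eq_monomial]
        simp [Polynomial.smul_eq_C_mul]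
      rw [diff_apply, h2]
      simp only [neg_smul]
      abel
    have hn : (n : ℂ) + 1 ≠ 0 := Nat.cast_add_one_ne_zero n
    refine ⟨(-(a / ((n : ℂ) + 1))) • b, ?_⟩
    rw [map_smul, h, smul_smul, Polynomial.smul_monomial]
    congr 1
    field_simp
    simp

theorem diff_neg_one_surjective : Function.Surjective (diff (-1)) := by
  intro f
  obtain ⟨g, hg⟩ := diff_one_surjective (taylor 1 f)
  refine ⟨-g, ?_⟩
  have h := congrArg (taylor (-1 : ℂ)) hg
  rw [diff_apply, map_sub, Polynomial.taylor_taylor, Polynomial.taylor_taylor] at h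
  simp only [neg_add_cancel, Polynomial.taylor_zero] at h
  rw [diff_apply, map_neg, ← h]
  abel

/-- A two-cocycle on `𝒟` with suitably normalized values vanishes. -/
theorem cocycle_eq_zero {M : Type*} [AddCommGroup M] [Module ℂ M]
    (B : diffOp →ₗ[ℂ] diffOp →ₗ[ℂ] M) (hskew : ∀ x y, B x y = -B y x)
    (hjac : ∀ x y z, B x ⁅y, z⁆ = B ⁅x, y⁆ z + B y ⁅x, z⁆)
    (hθ : ∀ r f, r ≠ 0 → B (hom 0 Polynomial.X) (hom r f) = 0)
    (ht : ∀ f, B (hom 1 1) (hom (-1) f) = 0) (x y : diffOp) : B x y = 0 := by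
  have hθl : ∀ r f, ⁅hom 0 Polynomial.X, hom r f⁆ = (r : ℂ) • hom r f := by
    intro r f
    rw [lie_hom, ← map_smul, zero_add]
    congr 1
    simp [add_mul, Polynomial.smul_eq_C_mul]
  have hdeg : ∀ r s f g, r + s ≠ 0 → B (hom r f) (hom s g) = 0 := by
    intro r s f g hrs
    have h := hjac (hom 0 Polynomial.X) (hom r f) (hom s g)
    rw [lie_hom, hθ _ _ hrs, hθl, hθl, map_smul, map_smul, LinearMap.smul_apply, ← add_smul] at h
    exact (smul_eq_zero.1 h.symm).resolve_left (by exact_mod_cast hrs)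
  have htl : ∀ r f, ⁅hom 1 1, hom r f⁆ = hom (1 + r) (diff 1 f) := by
    intro r f
    rw [lie_hom]; simp [diff_apply]
  have htl' : ∀ r f, ⁅hom (-1) 1, hom r f⁆ = hom (-1 + r) (diff (-1) f) := by
    intro r f
    rw [lie_hom]; simp [diff_apply]
  have step : ∀ r s f g, r + s = -1 →
      B (hom (1 + r) (diff 1 f)) (hom s g) = -B (hom r f) (hom (1 + s) (diff 1 g)) := by
    intro r s f g hrs
    have h := hjac (hom 1 1) (hom r f) (hom s g)
    rw [lie_hom, hrs, ht, htl, htl] at h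
    exact eq_neg_of_add_eq_zero_left h.symm
  have ht' : ∀ f, B (hom (-1) 1) (hom 1 f) = 0 := by
    intro f
    obtain ⟨g, rfl⟩ := diff_one_surjective f
    have h := step 0 (-1) g 1 (by norm_num)
    rw [add_zero] at h
    rw [hskew, h]
    simp [diff_apply]
  have step' : ∀ f g, B (hom (-1) (diff (-1) f)) (hom 1 g) = -B (hom 0 f) (hom 0 (diff (-1) g)) := by
    intro f g
    have h := hjac (hom (-1) 1) (hom 0 f) (hom 1 g)
    rw [lie_hom, zero_add, ht', htl', htl'] at h
    exact eq_neg_of_add_eq_zero_left h.symm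
  have hself : ∀ f g, B (hom 0 f) (hom 0 (diff 1 (diff (-1) g)))
      = B (hom 0 (diff (-1) (diff 1 f))) (hom 0 g) := by
    intro f g
    have h1 := step 0 (-1) f (diff (-1) g) (by norm_num)
    have h2 := step' g (diff 1 f)
    rw [add_zero] at h1
    rw [hskew, h1, neg_neg] at h2
    rw [hskew (hom 0 (diff (-1) (diff 1 f)))]
    exact h2
  have hzero : ∀ (n : ℕ) (f g : ℂ[X]), f.degree < n → B (hom 0 f) (hom 0 g) = 0 := by
    intro n
    induction n with
    | zero =>
      intro f g hf
      have : f = 0 := Polynomial.degree_eq_bot.1 (by simpa using hf)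
      simp [this]
    | succ n ih =>
      intro f g hf
      by_cases hf0 : f = 0
      · simp [hf0]
      obtain ⟨g, rfl⟩ := diff_one_surjective g
      obtain ⟨g, rfl⟩ := diff_neg_one_surjective g
      rw [hself]
      refine ih _ _ ((degree_diff_le _ _).trans_lt ?_)
      rw [Polynomial.degree_eq_natDegree hf0] at hf
      have h1 := degree_diff_lt 1 hf0
      rw [Polynomial.degree_eq_natDegree hf0] at h1
      refine h1.trans_le ?_
      have : f.natDegree < n + 1 := by exact_mod_cast hf
      exact_mod_cast Nat.lt_succ_iff.1 this
  have hpos : ∀ (r : ℕ) (f g : ℂ[X]), B (hom r f) (hom (-r) g) = 0 := by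
    intro r
    induction r with
    | zero =>
      intro f g
      simpa using hzero (f.natDegree + 1) f g
        (Polynomial.degree_le_natDegree.trans_lt (by exact_mod_cast Nat.lt_succ_self _))
    | succ r ih =>
      intro f g
      obtain ⟨f, rfl⟩ := diff_one_surjective f
      have h := step r (-((r + 1 : ℕ) : ℤ)) f g (by push_cast; ring)
      rw [show (1 : ℤ) + r = ((r + 1 : ℕ) : ℤ) by push_cast; ring,
        show (1 : ℤ) + -((r + 1 : ℕ) : ℤ) = -(r : ℤ) by push_cast; ring, ih, neg_zero] at h
      exact h
  induction x using diffOp_induction with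
  | h0 => simp
  | hadd A A' hA hA' => rw [map_add, LinearMap.add_apply, hA, hA', add_zero]
  | hhom r f =>
    induction y using diffOp_induction with
    | h0 => simp
    | hadd A A' hA hA' => rw [map_add, hA, hA', add_zero]
    | hhom s g =>
      by_cases hrs : r + s = 0
      · obtain rfl : s = -r := by lia
        obtain ⟨n, rfl | rfl⟩ := r.eq_nat_or_neg
        · exact hpos n f g
        · rw [hskew, neg_neg, hpos, neg_zero]
      · exact hdeg r s f g hrs

theorem psiFun_hom_nat (r : ℕ) (s : ℤ) (f g : ℂ[X]) :
    psiFun (hom r f) (hom s g) = if (r : ℤ) + s = 0 then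
      ∑ j ∈ Finset.Ico (-(r : ℤ)) 0, f.eval (j : ℂ) * g.eval ((j : ℂ) + r) else 0 :=
  psiFun_homog r s f g

theorem psiFun_hom_zero (s : ℤ) (f g : ℂ[X]) : psiFun (hom 0 f) (hom s g) = 0 := by
  simpa using psiFun_hom_nat 0 s f g

theorem psiFun_hom_one (g : ℂ[X]) : psiFun (hom 1 1) (hom (-1) g) = g.eval 0 := by
  have h : Finset.Ico (-1 : ℤ) 0 = {-1} := by decide
  simpa [h] using psiFun_hom_nat 1 (-1) 1 g

end DiffCircle

namespace DHat

open DiffCircle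

theorem isCentralExtension_proj : IsCentralExtension proj := by
  refine ⟨fun A => ⟨lift A, rfl⟩, ?_⟩
  rintro ⟨⟨A, a⟩⟩ hA ⟨⟨B, b⟩⟩
  obtain rfl : A = 0 := hA
  refine (lie_mk 0 B a b).trans ?_
  rw [zero_lie]
  have : psiFun (0 : diffOp) B = 0 := psiBilin.map_zero₂ B
  rw [this]
  rfl

set_option maxHeartbeats 2000000 in
/-- `𝒟̂` is the universal central extension of the Lie algebra of differential operators on the
circle. -/
theorem isUniversalCentralExtension.{w} : IsUniversalCentralExtension.{0, 0, w} proj := by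
  refine ⟨isCentralExtension_proj, fun E _ _ q hq => ?_⟩
  obtain ⟨hqs, hqc⟩ := hq
  have hlie : ∀ u v u' v' : E, q u = q u' → q v = q v' → ⁅u, v⁆ = ⁅u', v'⁆ := by
    intro u v u' v' hu hv
    have h1 : ⁅u - u', v⁆ = 0 := hqc _ (by rw [map_sub, hu, sub_self]) _
    have h2 : ⁅v - v', u'⁆ = 0 := hqc _ (by rw [map_sub, hv, sub_self]) _
    rw [sub_lie, sub_eq_zero] at h1 h2
    rw [h1, ← lie_skew, h2, lie_skew]
  obtain ⟨σ, hσ'⟩ := (q : E →ₗ[ℂ] diffOp).exists_rightInverse_of_surjective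
    (LinearMap.range_eq_top.2 hqs)
  have hσ : ∀ x, q (σ x) = x := fun x => LinearMap.congr_fun hσ' x
  obtain ⟨R, hR'⟩ := (diff 1).exists_rightInverse_of_surjective
    (LinearMap.range_eq_top.2 diff_one_surjective)
  have hR : ∀ x, diff 1 (R x) = x := fun x => LinearMap.congr_fun hR' x
  -- the bilinear map given by the bracket of lifts
  let b : diffOp →ₗ[ℂ] diffOp →ₗ[ℂ] E := LinearMap.mk₂ ℂ (fun x y => ⁅σ x, σ y⁆)
    (fun x x' y => by rw [map_add, add_lie]) (fun c x y => by rw [map_smul, smul_lie])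
    (fun x y y' => by rw [map_add, lie_add]) (fun c x y => by rw [map_smul, lie_smul])
  have hb : ∀ x y, b x y = ⁅σ x, σ y⁆ := fun x y => rfl
  have hqb : ∀ x y, q (b x y) = ⁅x, y⁆ := fun x y => by rw [hb, LieHom.map_lie, hσ, hσ]
  set c : E := b (hom 1 1) (hom (-1) 1) with hc
  have hqc' : q c = 0 := by
    rw [hc, hqb, lie_hom]; simp
  -- the section
  let sr : ℤ → ℂ[X] →ₗ[ℂ] E := fun r =>
    if r = 0 then b (hom 1 1) ∘ₗ hom (-1) ∘ₗ R -
        (LinearMap.toSpanSingleton ℂ E c) ∘ₗ (Polynomial.leval (0 : ℂ)) ∘ₗ R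
      else ((r : ℂ)⁻¹) • (b (hom 0 Polynomial.X) ∘ₗ hom r)
  let s : diffOp →ₗ[ℂ] E := Finsupp.lsum ℂ sr ∘ₗ components.symm.toLinearMap
  have hs : ∀ r f, s (hom r f) = sr r f := by
    intro r f
    have : components.symm (hom r f) = Finsupp.single r f := by
      rw [← components_single, LinearEquiv.symm_apply_apply]
    simp [s, this]
  have hs0 : ∀ f, s (hom 0 f) = b (hom 1 1) (hom (-1) (R f)) - (R f).eval 0 • c := by
    intro f
    rw [hs]; simp [sr]
  have hsr : ∀ r f, r ≠ 0 → s (hom r f) = (r : ℂ)⁻¹ • b (hom 0 Polynomial.X) (hom r f) := by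
    intro r f hr
    rw [hs]; simp [sr, hr]
  have hθl : ∀ r f, ⁅hom 0 Polynomial.X, hom r f⁆ = (r : ℂ) • hom r f := by
    intro r f
    rw [lie_hom, ← map_smul, zero_add]
    congr 1
    simp [add_mul, Polynomial.smul_eq_C_mul]
  have htl : ∀ r f, ⁅hom 1 1, hom r f⁆ = hom (1 + r) (diff 1 f) := by
    intro r f
    rw [lie_hom]; simp [diff_apply]
  have hqs : ∀ x, q (s x) = x := by
    intro x
    induction x using diffOp_induction with
    | h0 => simp
    | hadd A B hA hB => rw [map_add, map_add, hA, hB]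
    | hhom r f =>
      by_cases hr : r = 0
      · subst hr
        rw [hs0, map_sub, map_smul, hqb, hqc', smul_zero, sub_zero, htl, hR]
        simp
      · rw [hsr r f hr, map_smul, hqb, hθl, smul_smul, inv_mul_cancel₀ (by exact_mod_cast hr),
          one_smul]
  -- the defect of the section
  let B : diffOp →ₗ[ℂ] diffOp →ₗ[ℂ] E := LinearMap.mk₂ ℂ
    (fun x y => b x y - s ⁅x, y⁆ - psiBilin x y • c)
    (fun x x' y => by simp only [map_add, add_lie, LinearMap.add_apply, add_smul]; abel)
    (fun a x y => by
      simp only [map_smul, smul_lie, LinearMap.smul_apply, smul_sub, smul_eq_mul, mul_smul])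
    (fun x y y' => by simp only [map_add, lie_add, add_smul]; abel)
    (fun a x y => by simp only [map_smul, lie_smul, smul_sub, smul_eq_mul, mul_smul])
  have hB : ∀ x y, B x y = b x y - s ⁅x, y⁆ - psiBilin x y • c := fun x y => rfl
  have hbs : ∀ x y z, b x ⁅y, z⁆ = ⁅σ x, ⁅σ y, σ z⁆⁆ := fun x y z =>
    hlie _ _ _ _ rfl (by rw [hσ, LieHom.map_lie, hσ, hσ])
  have hbs' : ∀ x y z, b ⁅x, y⁆ z = ⁅⁅σ x, σ y⁆, σ z⁆ := fun x y z =>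
    hlie _ _ _ _ (by rw [hσ, LieHom.map_lie, hσ, hσ]) rfl
  have hB0 : ∀ x y, B x y = 0 := by
    refine cocycle_eq_zero B ?_ ?_ ?_ ?_
    · intro x y
      rw [hB, hB, hb, hb, ← lie_skew (σ x), ← lie_skew x y, psiBilin_swap x y, map_neg, neg_smul]
      abel
    · intro x y z
      rw [hB, hB, hB, hbs, hbs, hbs', psiBilin_jacobi, leibniz_lie (σ x), leibniz_lie x, map_add,
        add_smul]
      abel
    · intro r f hr
      have hp : psiBilin (hom 0 Polynomial.X) (hom r f) = 0 := psiFun_hom_zero _ _ _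
      rw [hB, hp, hθl, map_smul, hsr r f hr, smul_smul, mul_inv_cancel₀ (by exact_mod_cast hr)]
      simp
    · intro f
      have hp : psiBilin (hom 1 1) (hom (-1) f) = f.eval 0 := psiFun_hom_one f
      have hk : ∀ g : ℂ[X], diff 1 g = 0 → b (hom 1 1) (hom (-1) g) = g.eval 0 • c := by
        intro g hg
        have : g = Polynomial.C (g.eval 0) := by
          by_contra hne
          have hg0 : g - Polynomial.C (g.eval 0) ≠ 0 := sub_ne_zero.2 hne
          refine hg0 (Polynomial.eq_zero_of_infinite_isRoot _ ?_)
          refine Set.Infinite.mono ?_ (Set.infinite_range_of_injective (Nat.cast_injective (R := ℂ)))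
          rintro _ ⟨n, rfl⟩
          change Polynomial.eval _ _ = 0
          rw [Polynomial.eval_sub, Polynomial.eval_C, sub_eq_zero]
          induction n with
          | zero => simp
          | succ n ih =>
            rw [diff_apply, sub_eq_zero] at hg
            rw [← ih, Nat.cast_succ, ← Polynomial.taylor_eval, ← hg]
        have h2 : hom (-1) g = (g.eval 0) • hom (-1) 1 := by
          rw [← map_smul]
          conv_lhs => rw [this]
          simp [Polynomial.smul_eq_C_mul]
        rw [h2, map_smul]
      have h3 := hk (f - R (diff 1 f)) (by rw [map_sub, hR, sub_self])
      rw [map_sub, map_sub, Polynomial.eval_sub, sub_smul] at h3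
      rw [hB, hp, htl]
      change b (hom 1 1) (hom (-1) f) - s (hom 0 (diff 1 f)) - _ = 0
      rw [hs0]
      rw [← sub_eq_zero] at h3
      rw [← h3]
      abel
  let F : DHat →ₗ⁅ℂ⁆ E :=
    { toFun := fun x => s x.carrier.1 + (show ℂ from x.carrier.2) • c
      map_add' := fun x y => by
        change s (x.carrier.1 + y.carrier.1) +
          ((show ℂ from x.carrier.2) + (show ℂ from y.carrier.2)) • c = _
        rw [map_add, add_smul]; abel
      map_smul' := fun a x => by
        change s (a • x.carrier.1) + (a * (show ℂ from x.carrier.2)) • c = _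
        rw [map_smul, mul_smul, RingHom.id_apply, smul_add]
      map_lie' := by
        rintro ⟨⟨x, a⟩⟩ ⟨⟨y, a'⟩⟩
        change s ⁅x, y⁆ + (psiBilin x y + 0 - 0) • c
          = ⁅s x + (show ℂ from a) • c, s y + (show ℂ from a') • c⁆
        rw [add_zero, sub_zero]
        have h1 := hB0 x y
        rw [hB, sub_sub, sub_eq_zero] at h1
        rw [← h1]
        refine hlie _ _ _ _ ?_ ?_ <;> rw [map_add, map_smul, hqc', hqs, hσ, smul_zero, add_zero] }
  refine ⟨F, ?_, ?_⟩
  · rintro ⟨⟨x, a⟩⟩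
    change q (s x + (show ℂ from a) • c) = x
    rw [map_add, map_smul, hqc', hqs, smul_zero, add_zero]
  · intro G hG
    have hF : ∀ x, q (F x) = proj x := by
      rintro ⟨⟨x, a⟩⟩
      change q (s x + (show ℂ from a) • c) = x
      rw [map_add, map_smul, hqc', hqs, smul_zero, add_zero]
    have hbr : ∀ u v : DHat, G ⁅u, v⁆ = F ⁅u, v⁆ := by
      intro u v
      rw [LieHom.map_lie, LieHom.map_lie]
      exact hlie _ _ _ _ ((hG u).trans (hF u).symm) ((hG v).trans (hF v).symm)
    have hcen : G central = F central := by
      have : (central : DHat) = ⁅lift (hom 1 1), lift (hom (-1) 1)⁆ := by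
        rw [lie_lift, psiFun_hom_one, lie_hom]; simp
      rw [this, hbr]
    have hlift : ∀ A, G (lift A) = F (lift A) := by
      intro A
      induction A using diffOp_induction with
      | h0 => simp
      | hadd A B hA hB => rw [map_add, map_add, map_add, hA, hB]
      | hhom r f =>
        by_cases hr : r = 0
        · subst hr
          have h1 := lie_lift (hom 1 1) (hom (-1) (R f))
          rw [psiFun_hom_one, htl, hR] at h1
          have h2 : lift (hom 0 f) = ⁅lift (hom 1 1), lift (hom (-1) (R f))⁆
              - (R f).eval 0 • central := by
            rw [h1]; simp
          rw [h2, map_sub, map_sub, map_smul, map_smul, hbr, hcen]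
        · have h1 := lie_lift (hom 0 Polynomial.X) (hom r f)
          rw [psiFun_hom_zero, hθl, zero_smul, add_zero, map_smul] at h1
          have h2 : lift (hom r f) = (r : ℂ)⁻¹ • ⁅lift (hom 0 Polynomial.X), lift (hom r f)⁆ := by
            rw [h1, smul_smul, inv_mul_cancel₀ (by exact_mod_cast hr), one_smul]
          rw [h2, map_smul, map_smul, hbr]
    refine LieHom.ext fun x => ?_
    obtain ⟨⟨A, a⟩⟩ := x
    have hmk : ∀ d : ℂ, G (lift A + d • central) = F (lift A + d • central) := fun d => by
      rw [map_add, map_add, map_smul, map_smul, hlift, hcen]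
    exact (congrArg G (mk_eq A a)).trans ((hmk a).trans (congrArg F (mk_eq A a)).symm)

end DHat

/-! ### Irreducible submodules -/

/-- The subspace `W` is an irreducible submodule for the action `ρ`: it is stable, nonzero, and has
no stable subspaces except `0` and `W`. -/
def IsIrreducibleOn {L V : Type*} [LieRing L] [LieAlgebra ℂ L] [AddCommGroup V] [Module ℂ V]
    (ρ : L →ₗ⁅ℂ⁆ Module.End ℂ V) (W : Submodule ℂ V) : Prop :=
  (∀ x, ∀ v ∈ W, ρ x v ∈ W) ∧ W ≠ ⊥ ∧
    ∀ U : Submodule ℂ V, U ≤ W → (∀ x, ∀ v ∈ U, ρ x v ∈ U) → U = ⊥ ∨ U = W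

end

/-!
Pair the modes of the neutral fermion into `ψ_i = φ_{2i+1/2}` and `ψ*_i = φ_{-2i-1/2}`, and put
`ψ_i = ψ⁺_i`, `ψ*_i = ψ⁻_{-i-1}` for the charged fermions. In both cases the only nonzero
anticommutators are `{ψ_i, ψ*_i} = 1`, and the coefficient of `J^k_n` in the field is
`(-1)^k ∑_j f(j) :ψ_{j+n} ψ*_j:` with `f(j) = j (j - 1) ⋯ (j - k + 1)`. This is the second
quantisation of the operator `J^k_n = (-1)^k t^n f(t ∂_t)` on `ℂ[t, t⁻¹]`. Normal ordering makes
the second quantisation projective with cocycle `Ψ`, so `𝒟̂` acts, and `C` acts as the identity.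

A polynomial `f` can be prescribed at finitely many integers and only finitely many terms of a
current act nontrivially on a given vector, so a subspace stable under `𝒟̂` is stable under every
`ψ_i ψ*_j`. The `ψ_i ψ*_i` separate the monomials, and the other `ψ_i ψ*_j` connect the monomials
of the same charge; hence the vectors of a given charge form an irreducible module.

The two Fock spaces differ only in the labelling and the order of the modes, and a relabelling of
the modes, corrected by the sign of the reordering of each monomial, intertwines the actions.
-/

noncomputable section

open Fock FormalField HVertexOperator DiffCircle Filter

/-! ### Currents -/

/-- Two families of fermions `ψ_i`, `ψ*_i` (`i ∈ ℤ`) on a vector space: they satisfy the canonical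
anticommutation relations, and every vector is killed by almost all the `ψ_i` with `i ≥ 0` and by
almost all the `ψ*_i` with `i < 0`. -/
structure FermionModes (V : Type*) [AddCommGroup V] [Module ℂ V] where
  psi : ℤ → Module.End ℂ V
  psiStar : ℤ → Module.End ℂ V
  psi_psiStar : ∀ i j, psi i * psiStar j + psiStar j * psi i = if i = j then 1 else 0
  psi_psi : ∀ i j, psi i * psi j + psi j * psi i = 0
  psiStar_psiStar : ∀ i j, psiStar i * psiStar j + psiStar j * psiStar i = 0
  eventually_psi : ∀ v, ∀ᶠ i in atTop, psi i v = 0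
  eventually_psiStar : ∀ v, ∀ᶠ i in atBot, psiStar i v = 0

namespace FermionModes

variable {V : Type*} [AddCommGroup V] [Module ℂ V] (F : FermionModes V)

/-- The normally ordered product `:ψ_i ψ*_j:`, where `ψ_i` counts as a creation operator exactly
when `i < 0`. -/
def normalPair (i j : ℤ) : Module.End ℂ V :=
  if i < 0 then F.psi i * F.psiStar j else -(F.psiStar j * F.psi i)

theorem normalPair_eq (i j : ℤ) :
    F.normalPair i j = F.psi i * F.psiStar j - (if i = j then chi i else 0) • 1 := by
  rcases lt_or_ge i 0 with hi | hi
  · simp [normalPair, chi, hi, hi.not_ge]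
  · rw [normalPair, if_neg hi.not_gt, eq_sub_of_add_eq (F.psi_psiStar i j)]
    split_ifs <;> simp [chi, hi]

theorem lie_normalPair_psi (i j k : ℤ) :
    ⁅F.normalPair i j, F.psi k⁆ = if j = k then F.psi i else 0 := by
  have h : ⁅F.psi i * F.psiStar j, F.psi k⁆ = F.psi i * (F.psi k * F.psiStar j
      + F.psiStar j * F.psi k) - (F.psi i * F.psi k + F.psi k * F.psi i) * F.psiStar j := by
    rw [Ring.lie_def]
    noncomm_ring
  rw [normalPair_eq, sub_lie, h, F.psi_psiStar, F.psi_psi]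
  simp [Ring.lie_def, eq_comm]

theorem lie_normalPair_psiStar (i j k : ℤ) :
    ⁅F.normalPair i j, F.psiStar k⁆ = if i = k then -F.psiStar j else 0 := by
  have h : ⁅F.psi i * F.psiStar j, F.psiStar k⁆
      = F.psi i * (F.psiStar j * F.psiStar k + F.psiStar k * F.psiStar j)
        - (F.psi i * F.psiStar k + F.psiStar k * F.psi i) * F.psiStar j := by
    rw [Ring.lie_def]
    noncomm_ring
  rw [normalPair_eq, sub_lie, h, F.psi_psiStar, F.psiStar_psiStar]
  split_ifs <;> simp [Ring.lie_def]

theorem finite_normalPair (r : ℤ) (v : V) :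
    {j | F.normalPair (j + r) j v ≠ 0}.Finite := by
  change ∀ᶠ j in cofinite, F.normalPair (j + r) j v = 0
  rw [Int.cofinite_eq, eventually_sup]
  constructor
  · filter_upwards [F.eventually_psiStar v, eventually_lt_atBot (-r)] with j hj hr
    rw [normalPair, if_pos (by lia), Module.End.mul_apply, hj, map_zero]
  · filter_upwards [(tendsto_atTop_add_const_right atTop r tendsto_id).eventually
      (F.eventually_psi v), eventually_ge_atTop (-r)] with j hj hr
    rw [normalPair, if_neg (by lia), LinearMap.neg_apply, Module.End.mul_apply]
    simp only [id_eq] at hj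
    rw [hj, map_zero, neg_zero]

theorem finite_smul_normalPair (r : ℤ) (f : ℤ → ℂ) (v : V) :
    (Function.support fun j => f j • F.normalPair (j + r) j v).Finite :=
  (F.finite_normalPair r v).subset (Function.support_smul_subset_right _ _)

/-- The shift operator `∑_j f(j) :ψ_{j+r} ψ*_j:`, the second quantisation of the infinite matrix
`∑_j f(j) E_{j+r,j}`. -/
def current (r : ℤ) : (ℤ → ℂ) →ₗ[ℂ] Module.End ℂ V :=
  LinearMap.mk₂ ℂ (fun f v => ∑ᶠ j, f j • F.normalPair (j + r) j v)
    (fun f g v => by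
      rw [← finsum_add_distrib (F.finite_smul_normalPair r f v) (F.finite_smul_normalPair r g v)]
      simp only [Pi.add_apply, add_smul])
    (fun c f v => by
      rw [smul_finsum]
      simp only [Pi.smul_apply, smul_assoc])
    (fun f v w => by
      rw [← finsum_add_distrib (F.finite_smul_normalPair r f v) (F.finite_smul_normalPair r f w)]
      simp only [map_add, smul_add])
    (fun c f v => by
      rw [smul_finsum]
      simp only [map_smul, smul_comm c])

theorem current_apply (r : ℤ) (f : ℤ → ℂ) (v : V) :
    F.current r f v = ∑ᶠ j, f j • F.normalPair (j + r) j v := rfl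

theorem lie_current_apply (X : Module.End ℂ V) (r : ℤ) (f : ℤ → ℂ) (v : V) :
    ⁅X, F.current r f⁆ v = ∑ᶠ j, f j • ⁅X, F.normalPair (j + r) j⁆ v := by
  have hX : (Function.support fun j => X (f j • F.normalPair (j + r) j v)).Finite :=
    (F.finite_smul_normalPair r f v).subset (Function.support_comp_subset (map_zero X) _)
  rw [Ring.lie_def, LinearMap.sub_apply, Module.End.mul_apply, Module.End.mul_apply,
    current_apply, current_apply, map_finsum X (F.finite_smul_normalPair r f v),
    ← finsum_sub_distrib hX (F.finite_smul_normalPair r f (X v))]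
  simp only [Ring.lie_def, LinearMap.sub_apply, Module.End.mul_apply, map_smul, smul_sub]

theorem lie_current_psi (r : ℤ) (f : ℤ → ℂ) (k : ℤ) :
    ⁅F.current r f, F.psi k⁆ = f k • F.psi (k + r) := by
  ext v
  rw [← lie_skew, LinearMap.neg_apply, lie_current_apply, finsum_eq_single _ k]
  · rw [← lie_skew, lie_normalPair_psi, if_pos rfl]
    simp
  · intro j hj
    rw [← lie_skew, lie_normalPair_psi, if_neg hj]
    simp

theorem lie_current_psiStar (r : ℤ) (f : ℤ → ℂ) (k : ℤ) :
    ⁅F.current r f, F.psiStar k⁆ = -f (k - r) • F.psiStar (k - r) := by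
  ext v
  rw [← lie_skew, LinearMap.neg_apply, lie_current_apply, finsum_eq_single _ (k - r)]
  · rw [← lie_skew, lie_normalPair_psiStar, if_pos (sub_add_cancel k r)]
    simp
  · intro j hj
    rw [← lie_skew, lie_normalPair_psiStar, if_neg (fun h => hj (eq_sub_of_add_eq h))]
    simp

/-- The constant `f(i) (χ(j) - χ(i))` comes from the difference of `ψ_i ψ*_j` and
`:ψ_i ψ*_j:`. -/
theorem lie_current_normalPair (r : ℤ) (f : ℤ → ℂ) (i j : ℤ) :
    ⁅F.current r f, F.normalPair i j⁆
      = f i • F.normalPair (i + r) j - f (j - r) • F.normalPair i (j - r)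
        + (if i + r = j then f i * (chi j - chi i) else 0) • 1 := by
  have h : ⁅F.current r f, F.psi i * F.psiStar j⁆
      = ⁅F.current r f, F.psi i⁆ * F.psiStar j + F.psi i * ⁅F.current r f, F.psiStar j⁆ := by
    simp only [Ring.lie_def]
    noncomm_ring
  have hone (c : ℂ) : ⁅F.current r f, c • (1 : Module.End ℂ V)⁆ = 0 := by
    simp [Ring.lie_def]
  rw [F.normalPair_eq i j, lie_sub, h, hone, sub_zero, lie_current_psi, lie_current_psiStar,
    F.normalPair_eq (i + r), F.normalPair_eq i, smul_mul_assoc, mul_smul_comm]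
  by_cases hij : i + r = j
  · subst hij
    simp only [add_sub_cancel_right, if_true]
    module
  · rw [if_neg hij, if_neg hij, if_neg (fun h => hij (by lia))]
    module

/-- The summands of the central term of the bracket of the currents
`∑_j f(j) :ψ_{j+r} ψ*_j:` and `∑_k g(k) :ψ_{k+t} ψ*_k:`. -/
def schwinger (r t : ℤ) (f g : ℤ → ℂ) (k : ℤ) : ℂ :=
  if r + t = 0 then g k * (f (k + t) * (chi k - chi (k + t))) else 0

theorem schwinger_eq_zero {r t : ℤ} {f g : ℤ → ℂ} {k : ℤ} (hk : |t| < |k| ∨ |t| < |k + t|) :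
    schwinger r t f g k = 0 := by
  have hchi : chi k = chi (k + t) := by
    unfold chi
    congr 1
    grind
  rw [schwinger, hchi, sub_self, mul_zero, mul_zero, ite_self]

theorem support_schwinger_subset (r t : ℤ) (f g : ℤ → ℂ) :
    Function.support (schwinger r t f g) ⊆ Set.Icc (-|t|) |t| := fun _ hk =>
  abs_le.1 (not_lt.1 fun h => hk (schwinger_eq_zero (Or.inl h)))

theorem finite_support_schwinger (r t : ℤ) (f g : ℤ → ℂ) :
    (Function.support (schwinger r t f g)).Finite :=
  (Set.finite_Icc _ _).subset (support_schwinger_subset r t f g)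

theorem smul_lie_current_normalPair (r t : ℤ) (f g : ℤ → ℂ) (k : ℤ) :
    g k • ⁅F.current r f, F.normalPair (k + t) k⁆
      = (f (k + t) * g k) • F.normalPair (k + (r + t)) k
        - (f (k - r) * g (k - r + r)) • F.normalPair (k - r + (r + t)) (k - r)
        + schwinger r t f g k • 1 := by
  rw [lie_current_normalPair, show k + t + r = k + (r + t) by ring,
    show k - r + (r + t) = k + t by ring, sub_add_cancel]
  simp only [schwinger, add_eq_left]
  split_ifs <;> module

theorem lie_current_current (r t : ℤ) (f g : ℤ → ℂ) :
    ⁅F.current r f, F.current t g⁆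
      = F.current (r + t) (fun k => f (k + t) * g k - f k * g (k + r))
        + (∑ᶠ k, schwinger r t f g k) • 1 := by
  ext v
  let a (k : ℤ) : V := (f (k + t) * g k) • F.normalPair (k + (r + t)) k v
  let b (k : ℤ) : V := (f k * g (k + r)) • F.normalPair (k + (r + t)) k v
  have ha : (Function.support a).Finite := F.finite_smul_normalPair _ (fun k => f (k + t) * g k) v
  have hb : (Function.support b).Finite := F.finite_smul_normalPair _ (fun k => f k * g (k + r)) v
  have hb' : (Function.support fun k => b (k - r)).Finite :=
    hb.preimage (sub_left_injective.injOn)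
  have hs : (Function.support fun k => schwinger r t f g k • v).Finite :=
    (finite_support_schwinger r t f g).subset (Function.support_smul_subset_left _ _)
  have hshift : ∑ᶠ k, b (k - r) = ∑ᶠ k, b k := finsum_comp_equiv (Equiv.subRight r)
  calc ⁅F.current r f, F.current t g⁆ v
      = ∑ᶠ k, (a k - b (k - r) + schwinger r t f g k • v) := by
        rw [lie_current_apply]
        refine finsum_congr fun k => ?_
        rw [← LinearMap.smul_apply, smul_lie_current_normalPair]
        rfl
    _ = ∑ᶠ k, a k - ∑ᶠ k, b (k - r) + ∑ᶠ k, schwinger r t f g k • v := by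
        rw [finsum_add_distrib ((ha.union hb').subset (Function.support_sub _ _)) hs,
          finsum_sub_distrib ha hb']
    _ = ∑ᶠ k, (a k - b k) + (∑ᶠ k, schwinger r t f g k) • v := by
        rw [hshift, finsum_sub_distrib ha hb, finsum_smul]
    _ = _ := by
        rw [LinearMap.add_apply, current_apply]
        congr 1
        exact finsum_congr fun k => (sub_smul _ _ _).symm

end FermionModes

/-! ### Second quantisation of differential operators -/

theorem span_range_descPochhammer (R : Type*) [CommRing R] [IsDomain R] :
    Submodule.span R (Set.range (descPochhammer R)) = ⊤ := by
  let S : Polynomial.Sequence R :=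
    ⟨descPochhammer R, fun k => by
      rw [Polynomial.degree_eq_natDegree (monic_descPochhammer R k).ne_zero,
        descPochhammer_natDegree]⟩
  exact S.span fun k => (monic_descPochhammer R k).leadingCoeff.symm ▸ isUnit_one

namespace DiffCircle

/-- The values of a polynomial at the integers, i.e. the symbol of `t ^ r f(t ∂_t)` as a function
of the exponent. -/
def evalInt : ℂ[X] →ₗ[ℂ] ℤ → ℂ :=
  LinearMap.pi fun j => Polynomial.leval (j : ℂ)

theorem evalInt_apply (f : ℂ[X]) (j : ℤ) : evalInt f j = f.eval (j : ℂ) := rfl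

theorem psiFun_hom (r t : ℤ) (f g : ℂ[X]) :
    psiFun (hom r f) (hom t g)
      = ∑ᶠ k, FermionModes.schwinger r t (evalInt f) (evalInt g) k := by
  obtain ⟨w, -, hw⟩ := exists_banded (hom r f)
  let M := max w |t|
  let a (i j : ℤ) : ℂ := (chi i - chi j) * mat (homog r f) i j * mat (homog t g) j i
  have hdiag (i : ℤ) : a i (i + t) = FermionModes.schwinger r t (evalInt f) (evalInt g) i := by
    simp only [a, mat_homog, FermionModes.schwinger, evalInt_apply, if_true]
    by_cases hrt : r + t = 0
    · rw [if_pos (by lia), if_pos hrt]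
      ring
    · rw [if_neg (by lia), if_neg hrt]
      ring
  have hrow (i : ℤ) : ∑ j ∈ Finset.Icc (-M) M, a i j
      = FermionModes.schwinger r t (evalInt f) (evalInt g) i := by
    refine (Finset.sum_eq_single (i + t) (fun j _ hj => ?_) fun hi => ?_).trans (hdiag i)
    · simp only [a]
      rw [mat_homog t, if_neg hj, mul_zero]
    · rw [hdiag]
      refine FermionModes.schwinger_eq_zero (Or.inr (lt_of_not_ge fun h => hi ?_))
      exact Finset.mem_Icc.2 (abs_le.1 (h.trans (le_max_right _ _)))
  rw [psiFun_eq _ hw (le_max_left w |t|), finsum_eq_sum_of_support_subset (s := Finset.Icc (-M) M)]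
  · exact Finset.sum_congr rfl fun i _ => hrow i
  · rw [Finset.coe_Icc]
    exact (FermionModes.support_schwinger_subset r t _ _).trans
      (Set.Icc_subset_Icc (neg_le_neg (le_max_right _ _)) (le_max_right _ _))

theorem neg_derivT_pow (k : ℕ) :
    (-derivT) ^ k = homog (-k) ((-1 : ℂ) ^ k • descPochhammer ℂ k) := by
  induction k with
  | zero => simp [← mulOp_T, mulOp]; rfl
  | succ k ih =>
    rw [pow_succ', ih, derivT_eq, ← map_neg, homog_mul, descPochhammer_succ_right,
      show (-1 : ℤ) + -(k : ℤ) = -((k + 1 : ℕ) : ℤ) by push_cast; ring]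
    congr 1
    simp only [map_neg, Polynomial.taylor_X, Polynomial.smul_eq_C_mul, Int.cast_neg,
      Int.cast_natCast, map_pow, map_one, map_natCast]
    ring

theorem jOp_eq (k : ℕ) (n : ℤ) : jOp k n = (-1 : ℂ) ^ k • hom n (descPochhammer ℂ k) := by
  refine Subtype.ext ?_
  change mulOp (LaurentPolynomial.T (n + k)) * (-derivT) ^ k
    = (-1 : ℂ) ^ k • homog n (descPochhammer ℂ k)
  rw [neg_derivT_pow, mulOp_T, homog_mul]
  simp

theorem diffOp_linearMap_ext {M : Type*} [AddCommGroup M] [Module ℂ M] {φ ψ : diffOp →ₗ[ℂ] M}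
    (h : ∀ k n, φ (jOp k n) = ψ (jOp k n)) : φ = ψ := by
  have hhom (n : ℤ) : φ ∘ₗ hom n = ψ ∘ₗ hom n := by
    refine LinearMap.ext_on_range (span_range_descPochhammer ℂ) fun k => ?_
    have hk := h k n
    rw [jOp_eq, map_smul, map_smul] at hk
    exact smul_right_injective M (pow_ne_zero k (neg_ne_zero.2 one_ne_zero)) hk
  ext A
  induction A using diffOp_induction with
  | h0 => rw [map_zero, map_zero]
  | hadd A B hA hB => rw [map_add, map_add, hA, hB]
  | hhom r f => exact LinearMap.congr_fun (hhom r) f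

end DiffCircle

namespace DHat

theorem induction_lift {P : DHat → Prop} (hadd : ∀ x y, P x → P y → P (x + y))
    (hlift : ∀ A, P (lift A)) (hcentral : ∀ c : ℂ, P (c • central)) (x : DHat) : P x := by
  obtain ⟨⟨A, c⟩⟩ := x
  exact (mk_eq A c).symm ▸ hadd _ _ (hlift A) (hcentral c)

theorem induction_hom {P : DHat → Prop} (hadd : ∀ x y, P x → P y → P (x + y))
    (hhom : ∀ r f, P (lift (hom r f))) (hcentral : ∀ c : ℂ, P (c • central)) (x : DHat) : P x := by
  induction x using induction_lift with
  | hadd x y hx hy => exact hadd x y hx hy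
  | hcentral c => exact hcentral c
  | hlift A =>
    induction A using diffOp_induction with
    | h0 => simpa only [map_zero, zero_smul] using hcentral 0
    | hadd A B hA hB => exact map_add lift A B ▸ hadd _ _ hA hB
    | hhom r f => exact hhom r f

theorem central_eq_lie : central = ⁅J 0 1, J 0 (-1)⁆ := by
  have hJ (n : ℤ) : J 0 n = lift (hom n 1) := by
    rw [J, jOp_eq, pow_zero, one_smul, descPochhammer_zero]
  rw [hJ, hJ, lie_lift, psiFun_hom_one, lie_hom]
  simp

theorem hom_ext {L : Type*} [LieRing L] [LieAlgebra ℂ L] {f g : DHat →ₗ⁅ℂ⁆ L}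
    (h : ∀ k n, f (J k n) = g (J k n)) : f = g := by
  have hlift : (f : DHat →ₗ[ℂ] L) ∘ₗ lift = (g : DHat →ₗ[ℂ] L) ∘ₗ lift := diffOp_linearMap_ext h
  ext x
  induction x using induction_lift with
  | hadd x y hx hy => rw [map_add, map_add, hx, hy]
  | hlift A => exact LinearMap.congr_fun hlift A
  | hcentral c =>
    rw [map_smul, map_smul, central_eq_lie, LieHom.map_lie, LieHom.map_lie, h, h]

/-- The homomorphism out of the central extension `𝒟 ⊕ ℂ C` which restricts to `φ` on `𝒟` and
sends `C` to `z`: a projective representation `φ` of `𝒟` with cocycle `Ψ z` is a representation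
of `𝒟̂`. -/
def ofProjective {L : Type*} [LieRing L] [LieAlgebra ℂ L] (φ : diffOp →ₗ[ℂ] L) (z : L)
    (hz : ∀ x : L, ⁅z, x⁆ = 0) (hφ : ∀ A B, ⁅φ A, φ B⁆ = φ ⁅A, B⁆ + psiFun A B • z) :
    DHat →ₗ⁅ℂ⁆ L where
  toFun x := φ x.carrier.1 + (show ℂ from x.carrier.2) • z
  map_add' x y := by
    change φ (x.carrier.1 + y.carrier.1)
      + ((show ℂ from x.carrier.2) + (show ℂ from y.carrier.2)) • z = _
    rw [map_add, add_smul, add_add_add_comm]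
  map_smul' c x := by
    change φ (c • x.carrier.1) + (c * (show ℂ from x.carrier.2)) • z = _
    rw [map_smul, mul_smul, RingHom.id_apply, smul_add]
  map_lie' := by
    rintro ⟨⟨A, (a : ℂ)⟩⟩ ⟨⟨B, (b : ℂ)⟩⟩
    have hz' (x : L) : ⁅x, z⁆ = 0 := by rw [← lie_skew, hz, neg_zero]
    change φ ⁅A, B⁆ + (psiFun A B + 0 - 0) • z = ⁅φ A + a • z, φ B + b • z⁆
    simp only [add_lie, lie_add, smul_lie, lie_smul, hz, hz', hφ, smul_zero, add_zero, sub_zero]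

theorem ofProjective_lift {L : Type*} [LieRing L] [LieAlgebra ℂ L] {φ : diffOp →ₗ[ℂ] L} {z : L}
    (hz : ∀ x : L, ⁅z, x⁆ = 0) (hφ : ∀ A B, ⁅φ A, φ B⁆ = φ ⁅A, B⁆ + psiFun A B • z) (A : diffOp) :
    ofProjective φ z hz hφ (lift A) = φ A := by
  change φ A + (0 : ℂ) • z = φ A
  rw [zero_smul, add_zero]

theorem ofProjective_central {L : Type*} [LieRing L] [LieAlgebra ℂ L] {φ : diffOp →ₗ[ℂ] L} {z : L}
    (hz : ∀ x : L, ⁅z, x⁆ = 0) (hφ : ∀ A B, ⁅φ A, φ B⁆ = φ ⁅A, B⁆ + psiFun A B • z) :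
    ofProjective φ z hz hφ central = z := by
  change φ 0 + (1 : ℂ) • z = z
  rw [map_zero, zero_add, one_smul]

end DHat

namespace FermionModes

variable {V : Type*} [AddCommGroup V] [Module ℂ V] (F : FermionModes V)

/-- The second quantisation of differential operators, acting on `ℂ[t, t⁻¹]` through the matrices
of their coefficients. -/
def currentMap : diffOp →ₗ[ℂ] Module.End ℂ V :=
  Finsupp.lsum ℂ (fun r => F.current r ∘ₗ evalInt) ∘ₗ components.symm.toLinearMap

theorem currentMap_hom (r : ℤ) (f : ℂ[X]) : F.currentMap (hom r f) = F.current r (evalInt f) := by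
  rw [← components_single]
  simp [currentMap]

theorem lie_currentMap (A B : diffOp) :
    ⁅F.currentMap A, F.currentMap B⁆ = F.currentMap ⁅A, B⁆ + psiFun A B • 1 := by
  rw [← psiBilin_apply]
  induction A using diffOp_induction with
  | h0 => simp
  | hadd A A' hA hA' =>
    rw [map_add, add_lie, hA, hA', add_lie, map_add, map_add, LinearMap.add_apply, add_smul,
      add_add_add_comm]
  | hhom r f =>
    induction B using diffOp_induction with
    | h0 => simp
    | hadd B B' hB hB' =>
      rw [map_add, lie_add, hB, hB', lie_add, map_add, map_add, add_smul, add_add_add_comm]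
    | hhom t g =>
      rw [lie_hom, currentMap_hom, currentMap_hom, currentMap_hom, lie_current_current,
        psiBilin_apply, psiFun_hom]
      congr 2
      ext j
      simp [evalInt_apply, Polynomial.taylor_eval]

/-- The representation of `𝒟̂` with central charge one defined by two families of fermions. -/
def rep : DHat →ₗ⁅ℂ⁆ Module.End ℂ V :=
  DHat.ofProjective F.currentMap 1 (fun X => by simp [Ring.lie_def]) F.lie_currentMap

theorem rep_lift_hom (r : ℤ) (f : ℂ[X]) :
    F.rep (DHat.lift (hom r f)) = F.current r (evalInt f) :=
  (DHat.ofProjective_lift _ _ _).trans (F.currentMap_hom r f)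

theorem rep_central : F.rep DHat.central = 1 := DHat.ofProjective_central _ _

theorem rep_J (k : ℕ) (n : ℤ) (v : V) :
    F.rep (DHat.J k n) v
      = (-1 : ℂ) ^ k • ∑ᶠ j : ℤ, (descPochhammer ℂ k).eval (j : ℂ) • F.normalPair (j + n) j v := by
  rw [DHat.J, jOp_eq, map_smul, map_smul, rep_lift_hom]
  rfl

end FermionModes

/-! ### Coefficients of the fermion fields -/

namespace Fock

variable {ι : Type} [LinearOrder ι]

/-- A creation operator if `c` holds, and an annihilation operator otherwise. -/
def mode (c : Prop) [Decidable c] (i : ι) : Module.End ℂ (Fock ι) :=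
  if c then create i else annih i

theorem mode_mode (c d : Prop) [Decidable c] [Decidable d] (i j : ι) :
    mode c i * mode d j + mode d j * mode c i = if i = j ∧ ¬(c ↔ d) then 1 else 0 := by
  by_cases hc : c <;> by_cases hd : d <;> simp only [mode, hc, hd, if_true, if_false]
  · simp [create_create]
  · rw [add_comm, annih_create]
    simp [eq_comm]
  · rw [annih_create]
    simp
  · simp [annih_annih]

theorem eventually_annih (v : Fock ι) : ∀ᶠ i in cofinite, annih i v = 0 :=
  finite_annih v

/-- The fermions on a Fock space whose creation and annihilation operators are indexed by the
integers: `ψ_i` is a creation operator for `i < 0` and an annihilation operator for `i ≥ 0`, and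
`ψ*_i` is the other operator with the same index. -/
def fermionModes (s : ℤ ≃ ι) : FermionModes (Fock ι) where
  psi i := mode (i < 0) (s i)
  psiStar i := mode (0 ≤ i) (s i)
  psi_psiStar i j := by
    rw [mode_mode]
    exact if_congr (by rw [s.apply_eq_iff_eq]; lia) rfl rfl
  psi_psi i j := by
    rw [mode_mode]
    exact if_neg (by rw [s.apply_eq_iff_eq]; lia)
  psiStar_psiStar i j := by
    rw [mode_mode]
    exact if_neg (by rw [s.apply_eq_iff_eq]; lia)
  eventually_psi v := by
    have h := s.injective.tendsto_cofinite.eventually (eventually_annih v)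
    rw [Int.cofinite_eq, eventually_sup] at h
    filter_upwards [h.2, eventually_ge_atTop 0] with i hi hi0
    rw [mode, if_neg hi0.not_gt, hi]
  eventually_psiStar v := by
    have h := s.injective.tendsto_cofinite.eventually (eventually_annih v)
    rw [Int.cofinite_eq, eventually_sup] at h
    filter_upwards [h.1, eventually_lt_atBot 0] with i hi hi0
    rw [mode, if_neg hi0.not_ge, hi]

end Fock

theorem finsum_comp_of_support_subset_range {α β M : Type*} [AddCommMonoid M] {e : α → β}
    (he : Function.Injective e) {f : β → M} (hf : Function.support f ⊆ Set.range e) :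
    ∑ᶠ a, f (e a) = ∑ᶠ b, f b := by
  rw [← finsum_mem_range he, ← finsum_mem_inter_support, Set.inter_eq_right.2 hf,
    finsum_mem_support]

namespace FormalField

variable {V : Type} [AddCommGroup V] [Module ℂ V]

theorem coeff_reflect (a : VertexOperator ℂ V) (m : ℤ) :
    coeff (reflect a) m = ((-1 : ℂ) ^ m) • coeff a m := rfl

theorem coeff_mulZ (k : ℤ) (a : VertexOperator ℂ V) (m : ℤ) :
    coeff (mulZ k a) m = coeff a (m - k) := rfl

theorem coeff_derivZ (a : VertexOperator ℂ V) (m : ℤ) :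
    coeff (derivZ a) m = ((m : ℂ) + 1) • coeff a (m + 1) := rfl

theorem coeff_derivZSq (a : VertexOperator ℂ V) (m : ℤ) :
    coeff (derivZSq a) m = ((m : ℂ) / 2 + 1) • coeff a (m + 2) := by
  rw [derivZSq, map_smul, Pi.smul_apply, coeff_mulZ, coeff_derivZ, smul_smul,
    show m - -1 + 1 = m + 2 by ring]
  congr 1
  push_cast
  ring

theorem coeff_derivZ_iterate (a : VertexOperator ℂ V) (k : ℕ) (m : ℤ) :
    coeff (derivZ^[k] a) m = (descPochhammer ℂ k).eval ((m : ℂ) + k) • coeff a (m + k) := by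
  induction k generalizing m with
  | zero => simp
  | succ k ih =>
    rw [Function.iterate_succ_apply', coeff_derivZ, ih, smul_smul, descPochhammer_succ_eval,
      show m + 1 + (k : ℤ) = m + ((k + 1 : ℕ) : ℤ) by push_cast; ring]
    congr 1
    push_cast
    rw [show (m : ℂ) + 1 + k = m + (k + 1) by ring]
    ring

theorem coeff_derivZSq_iterate (a : VertexOperator ℂ V) (k : ℕ) (m : ℤ) :
    coeff (derivZSq^[k] a) m
      = (descPochhammer ℂ k).eval ((m : ℂ) / 2 + k) • coeff a (m + 2 * k) := by
  induction k generalizing m with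
  | zero => simp
  | succ k ih =>
    rw [Function.iterate_succ_apply', coeff_derivZSq, ih, smul_smul, descPochhammer_succ_eval,
      show m + 2 + 2 * (k : ℤ) = m + 2 * ((k + 1 : ℕ) : ℤ) by push_cast; ring]
    congr 1
    push_cast
    rw [show ((m : ℂ) + 2) / 2 + k = m / 2 + (k + 1) by ring]
    ring

theorem coeff_sub_reflect (a : VertexOperator ℂ V) (m : ℤ) :
    coeff (a - reflect a) m = (if Odd m then 2 else 0 : ℂ) • coeff a m := by
  rw [map_sub, Pi.sub_apply, coeff_reflect]
  split_ifs with h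
  · rw [h.neg_one_zpow, two_smul, neg_one_smul, sub_neg_eq_add]
  · rw [(Int.not_odd_iff_even.1 h).neg_one_zpow, one_smul, sub_self, zero_smul]

theorem coeff_add_reflect (a : VertexOperator ℂ V) (m : ℤ) :
    coeff (a + reflect a) m = (if Even m then 2 else 0 : ℂ) • coeff a m := by
  rw [map_add, Pi.add_apply, coeff_reflect]
  split_ifs with h
  · rw [h.neg_one_zpow, one_smul, two_smul]
  · rw [(Int.not_even_iff_odd.1 h).neg_one_zpow, neg_one_smul, add_neg_cancel, zero_smul]

theorem normalOrdCoeff_eq_smul {a a' b b' : VertexOperator ℂ V} {i j l : ℤ} {x y : ℂ}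
    (ha : coeff a i = x • coeff a' i) (hb : coeff b j = y • coeff b' l) :
    normalOrdCoeff a b i j = (x * y) • normalOrdCoeff a' b' i l := by
  unfold normalOrdCoeff
  rw [ha, hb]
  split_ifs
  · rw [smul_mul_smul_comm]
  · rw [smul_mul_smul_comm, smul_neg, mul_comm]

theorem coeff_normalOrd_derivZ (a b : VertexOperator ℂ V) (k : ℕ) (n : ℤ) (v : V) :
    coeff (normalOrd a (derivZ^[k] b)) (-(k : ℤ) - n - 1) v
      = ∑ᶠ j : ℤ, (descPochhammer ℂ k).eval (j : ℂ) • normalOrdCoeff a b (-1 - (j + n)) j v := by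
  rw [coeff_normalOrd, ← finsum_comp_equiv (Equiv.subLeft (-1 - n))]
  refine finsum_congr fun j => ?_
  have hb : coeff (derivZ^[k] b) (-(k : ℤ) - n - 1 - (-1 - n - j))
      = (descPochhammer ℂ k).eval (j : ℂ) • coeff b j := by
    rw [coeff_derivZ_iterate, show -(k : ℤ) - n - 1 - (-1 - n - j) = j - k by ring,
      sub_add_cancel, Int.cast_sub, Int.cast_natCast, sub_add_cancel]
  rw [Equiv.subLeft_apply, normalOrdCoeff_eq_smul (one_smul ℂ _).symm hb, one_mul,
    LinearMap.smul_apply, show -1 - n - j = -1 - (j + n) by ring]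

theorem normalOrdCoeff_sub_reflect_derivZSq (a : VertexOperator ℂ V) (k : ℕ) (i m : ℤ) :
    normalOrdCoeff (a - reflect a) (derivZSq^[k] (a + reflect a)) i m
      = ((if Odd i then 2 else 0) * ((descPochhammer ℂ k).eval ((m : ℂ) / 2 + k)
        * if Even m then 2 else 0)) • normalOrdCoeff a a i (m + 2 * k) := by
  refine normalOrdCoeff_eq_smul (coeff_sub_reflect a i) ?_
  rw [coeff_derivZSq_iterate, coeff_add_reflect, smul_smul]
  simp only [Int.even_add, even_two_mul, iff_true]

theorem coeff_normalOrd_derivZSq (a : VertexOperator ℂ V) (k : ℕ) (n : ℤ) (v : V) :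
    coeff (mulZ (-1) (normalOrd (a - reflect a) (derivZSq^[k] (a + reflect a))))
        (-2 * (k : ℤ) - 2 * n - 2) v
      = (4 : ℂ) • ∑ᶠ j : ℤ, (descPochhammer ℂ k).eval (j : ℂ) •
        normalOrdCoeff a a (-1 - 2 * (j + n)) (2 * j) v := by
  have hinj : Function.Injective fun j : ℤ => -1 - 2 * (j + n) := fun x y h => by
    simp only at h
    lia
  rw [coeff_mulZ, coeff_normalOrd, ← finsum_comp_of_support_subset_range hinj, smul_finsum]
  · refine finsum_congr fun j => ?_
    have hodd : Odd (-1 - 2 * (j + n)) := ⟨-1 - (j + n), by ring⟩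
    have hm : -2 * (k : ℤ) - 2 * n - 2 - -1 - (-1 - 2 * (j + n)) = 2 * (j - k) := by ring
    have hj : ((2 * (j - k) : ℤ) : ℂ) / 2 + k = j := by
      push_cast
      ring
    rw [hm, normalOrdCoeff_sub_reflect_derivZSq, if_pos hodd, if_pos (even_two_mul _), hj,
      show 2 * (j - k) + 2 * (k : ℤ) = 2 * j by ring, LinearMap.smul_apply, smul_smul]
    congr 1
    ring
  · intro i hi
    by_contra hrange
    have hodd : ¬Odd i := fun ⟨l, hl⟩ => hrange ⟨-1 - l - n, by lia⟩
    refine hi ?_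
    simp only [normalOrdCoeff_sub_reflect_derivZSq, if_neg hodd, zero_mul, zero_smul,
      LinearMap.zero_apply]

theorem coeff_normalOrd_derivZSq_odd (a : VertexOperator ℂ V) (k : ℕ) {m : ℤ} (hm : Odd m) :
    coeff (mulZ (-1) (normalOrd (a - reflect a) (derivZSq^[k] (a + reflect a)))) m = 0 := by
  ext v
  rw [coeff_mulZ, coeff_normalOrd]
  refine finsum_eq_zero_of_forall_eq_zero fun i => ?_
  rw [normalOrdCoeff_sub_reflect_derivZSq]
  by_cases hi : Odd i
  · rw [if_neg (c := Even _) (by grind), mul_zero, mul_zero, zero_smul, LinearMap.zero_apply]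
  · rw [if_neg hi, zero_mul, zero_smul, LinearMap.zero_apply]

end FormalField

namespace FermionModes

theorem normalOrdCoeff_eq_normalPair {V : Type} [AddCommGroup V] [Module ℂ V]
    {F : FermionModes V} {a b : VertexOperator ℂ V} {i j m l : ℤ} (ha : coeff a m = F.psi i)
    (hb : coeff b l = F.psiStar j) (hm : 0 ≤ m ↔ i < 0) :
    normalOrdCoeff a b m l = F.normalPair i j := by
  rw [normalOrdCoeff, normalPair, ha, hb]
  exact if_congr hm rfl rfl

end FermionModes

theorem intEquivNat_of_neg {i : ℤ} (hi : i < 0) : Equiv.intEquivNat i = (-1 - 2 * i).toNat := by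
  obtain ⟨n, rfl⟩ := Int.eq_negSucc_of_lt_zero hi
  change 2 * n + 1 = _
  lia

theorem intEquivNat_of_nonneg {i : ℤ} (hi : 0 ≤ i) : Equiv.intEquivNat i = (2 * i).toNat := by
  obtain ⟨n, rfl⟩ := Int.eq_ofNat_of_zero_le hi
  change 2 * n = _
  lia

/-- The two halves `ψ_i = φ_{2i+1/2}` and `ψ*_i = φ_{-2i-1/2}` of the neutral fermion. -/
abbrev neutralModes : FermionModes FockD := fermionModes Equiv.intEquivNat

/-- The modes `ψ_i = ψ⁺_i` and `ψ*_i = ψ⁻_{-i-1}` of the charged fermions. -/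
abbrev chargedModes : FermionModes FockA := fermionModes (Equiv.subLeft (-1))

theorem neutralModes_psi (i : ℤ) : coeff phiD (-1 - 2 * i) = neutralModes.psi i := by
  change phiCoeff (-1 - 2 * i) = mode (i < 0) (Equiv.intEquivNat i)
  unfold phiCoeff mode
  by_cases hi : i < 0
  · rw [if_pos hi, if_pos (by lia), intEquivNat_of_neg hi]
  · rw [if_neg hi, if_neg (by lia), intEquivNat_of_nonneg (by lia)]
    congr 2
    ring

theorem neutralModes_psiStar (i : ℤ) : coeff phiD (2 * i) = neutralModes.psiStar i := by
  change phiCoeff (2 * i) = mode (0 ≤ i) (Equiv.intEquivNat i)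
  unfold phiCoeff mode
  by_cases hi : 0 ≤ i
  · rw [if_pos hi, if_pos (by lia), intEquivNat_of_nonneg hi]
  · rw [if_neg hi, if_neg (by lia), intEquivNat_of_neg (by lia)]
    congr 2
    ring

theorem chargedModes_psi (i : ℤ) : coeff psiPlus (-1 - i) = chargedModes.psi i := by
  change psiPlusMode (-(-1 - i) - 1) = mode (i < 0) (-1 - i)
  rw [psiPlusMode, mode, show -(-1 - i) - 1 = i by ring, show -i - 1 = -1 - i by ring]

theorem chargedModes_psiStar (i : ℤ) : coeff psiMinus i = chargedModes.psiStar i := by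
  change psiMinusMode (-i - 1) = mode (0 ≤ i) (-1 - i)
  rw [psiMinusMode, mode, show -i - 1 = -1 - i by ring]
  exact if_congr (by lia) rfl rfl

theorem rep_neutralModes_J (k : ℕ) (n : ℤ) :
    neutralModes.rep (DHat.J k n) = coeff (currentD k) (-2 * (k : ℤ) - 2 * n - 2) := by
  refine LinearMap.ext fun v => ?_
  have hpair (j : ℤ) : normalOrdCoeff phiD phiD (-1 - 2 * (j + n)) (2 * j)
      = neutralModes.normalPair (j + n) j :=
    FermionModes.normalOrdCoeff_eq_normalPair (neutralModes_psi _) (neutralModes_psiStar j)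
      (by lia)
  rw [FermionModes.rep_J, currentD, map_smul, Pi.smul_apply, LinearMap.smul_apply,
    coeff_normalOrd_derivZSq, smul_smul, div_mul_cancel₀ _ (by norm_num : (4 : ℂ) ≠ 0)]
  simp only [hpair]

theorem rep_chargedModes_J (k : ℕ) (n : ℤ) :
    chargedModes.rep (DHat.J k n) = coeff (currentA k) (-(k : ℤ) - n - 1) := by
  refine LinearMap.ext fun v => ?_
  have hpair (j : ℤ) : normalOrdCoeff psiPlus psiMinus (-1 - (j + n)) j
      = chargedModes.normalPair (j + n) j :=
    FermionModes.normalOrdCoeff_eq_normalPair (chargedModes_psi _) (chargedModes_psiStar j)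
      (by lia)
  rw [FermionModes.rep_J, currentA, map_smul, Pi.smul_apply, LinearMap.smul_apply,
    coeff_normalOrd_derivZ]
  simp only [hpair]

theorem coeff_currentD_odd (k : ℕ) {m : ℤ} (hm : Odd m) : coeff (currentD k) m = 0 := by
  rw [currentD, map_smul, Pi.smul_apply, coeff_normalOrd_derivZSq_odd phiD k hm, smul_zero]

/-! ### Relabelling of the modes -/

namespace FermionModes

variable {V W : Type*} [AddCommGroup V] [Module ℂ V] [AddCommGroup W] [Module ℂ W]

theorem map_rep (F : FermionModes V) (G : FermionModes W) (e : V →ₗ[ℂ] W)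
    (hpsi : ∀ i v, e (F.psi i v) = G.psi i (e v))
    (hpsiStar : ∀ i v, e (F.psiStar i v) = G.psiStar i (e v)) (x : DHat) (v : V) :
    e (F.rep x v) = G.rep x (e v) := by
  induction x using DHat.induction_hom with
  | hadd x y hx hy =>
    rw [map_add, map_add, LinearMap.add_apply, LinearMap.add_apply, map_add, hx, hy]
  | hcentral c => simp [rep_central]
  | hhom r f =>
    rw [rep_lift_hom, rep_lift_hom, current_apply, current_apply,
      map_finsum e (F.finite_smul_normalPair r _ v)]
    refine finsum_congr fun j => ?_
    rw [map_smul, normalPair, normalPair]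
    split_ifs
    · rw [Module.End.mul_apply, Module.End.mul_apply, hpsi, hpsiStar]
    · rw [LinearMap.neg_apply, LinearMap.neg_apply, Module.End.mul_apply, Module.End.mul_apply,
        map_neg, hpsiStar, hpsi]

end FermionModes

namespace Fock

variable {ι κ : Type} [LinearOrder ι] [LinearOrder κ]

/-- The sign of the permutation which reorders the factors of the monomial of `S` under a
relabelling `σ` of the modes. -/
def reorderSgn (σ : ι ≃ κ) (S : Finset ι) : ℂ :=
  ∏ i ∈ S, ∏ j ∈ S, if i < j ∧ σ j < σ i then -1 else 1

theorem reorderSgn_ne_zero (σ : ι ≃ κ) (S : Finset ι) : reorderSgn σ S ≠ 0 :=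
  Finset.prod_ne_zero_iff.2 fun i _ => Finset.prod_ne_zero_iff.2 fun j _ => by
    split_ifs <;> simp

theorem sgn_eq_prod (S : Finset ι) (i : ι) : sgn S i = ∏ j ∈ S, if i < j then -1 else 1 := by
  rw [sgn, Finset.prod_ite, Finset.prod_const, Finset.prod_const_one, mul_one]

theorem reorderSgn_insert (σ : ι ≃ κ) {S : Finset ι} {i : ι} (hi : i ∉ S) :
    reorderSgn σ (insert i S)
      = reorderSgn σ S * (sgn S i * sgn (S.map σ.toEmbedding) (σ i)) := by
  have hprod : (∏ j ∈ S, if i < j ∧ σ j < σ i then (-1 : ℂ) else 1) *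
      (∏ j ∈ S, if j < i ∧ σ i < σ j then (-1 : ℂ) else 1)
      = sgn S i * sgn (S.map σ.toEmbedding) (σ i) := by
    rw [sgn_eq_prod, sgn_eq_prod, Finset.prod_map, ← Finset.prod_mul_distrib,
      ← Finset.prod_mul_distrib]
    refine Finset.prod_congr rfl fun j hj => ?_
    have hij : i ≠ j := fun h => hi (h ▸ hj)
    have hσ : σ i ≠ σ j := σ.injective.ne hij
    rw [Equiv.coe_toEmbedding]
    rcases lt_or_gt_of_ne hij with h | h <;> rcases lt_or_gt_of_ne hσ with h' | h' <;>
      simp [h, h.not_gt, h', h'.not_gt]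
  rw [← hprod]
  simp only [reorderSgn, Finset.prod_insert hi, Finset.prod_mul_distrib, lt_irrefl, false_and,
    if_false]
  ring

/-- The isomorphism of Fock spaces which relabels the modes by `σ`. -/
def relabel (σ : ι ≃ κ) : Fock ι ≃ₗ[ℂ] Fock κ :=
  (Finsupp.basisSingleOne.isUnitSMul fun S => (reorderSgn_ne_zero σ S).isUnit).equiv
    Finsupp.basisSingleOne σ.finsetCongr

theorem relabel_mono (σ : ι ≃ κ) (S : Finset ι) :
    relabel σ (reorderSgn σ S • mono S) = mono (S.map σ.toEmbedding) := by
  have h := (Finsupp.basisSingleOne.isUnitSMul fun S => (reorderSgn_ne_zero σ S).isUnit).equiv_apply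
    S (Finsupp.basisSingleOne (R := ℂ)) σ.finsetCongr
  rwa [Module.Basis.isUnitSMul_apply, Finsupp.coe_basisSingleOne, Finsupp.coe_basisSingleOne] at h

theorem relabel_vac (σ : ι ≃ κ) : relabel σ vac = vac := by
  have h := relabel_mono σ ∅
  rwa [reorderSgn, Finset.prod_empty, one_smul, Finset.map_empty] at h

theorem relabel_create (σ : ι ≃ κ) (i : ι) (v : Fock ι) :
    relabel σ (create i v) = create (σ i) (relabel σ v) := by
  suffices h : (relabel σ).toLinearMap ∘ₗ create i = create (σ i) ∘ₗ (relabel σ).toLinearMap from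
    LinearMap.congr_fun h v
  refine (Finsupp.basisSingleOne.isUnitSMul fun S => (reorderSgn_ne_zero σ S).isUnit).ext
    fun S => ?_
  rw [Module.Basis.isUnitSMul_apply, Finsupp.coe_basisSingleOne]
  change relabel σ (create i (reorderSgn σ S • mono S))
    = create (σ i) (relabel σ (reorderSgn σ S • mono S))
  rw [relabel_mono, map_smul, create_mono, create_mono]
  by_cases hi : i ∈ S
  · simp [hi]
  · have hsgn : reorderSgn σ S * sgn S i
        = sgn (S.map σ.toEmbedding) (σ i) * reorderSgn σ (insert i S) := by
      rw [reorderSgn_insert σ hi]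
      linear_combination -(reorderSgn σ S * sgn S i) * sgn_mul_self (S.map σ.toEmbedding) (σ i)
    rw [if_neg hi, if_neg (by simpa using hi), smul_smul, hsgn, mul_smul, map_smul, relabel_mono,
      Finset.map_insert]
    rfl

theorem annih_create_apply (i j : ι) (v : Fock ι) :
    annih i (create j v) = (if i = j then v else 0) - create j (annih i v) := by
  have h := LinearMap.congr_fun (annih_create i j) v
  rw [LinearMap.add_apply, Module.End.mul_apply, Module.End.mul_apply] at h
  rw [eq_sub_of_add_eq h]
  split_ifs <;> rfl

/-- The annihilation operators are determined by the anticommutation relations and their values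
at the vacuum. -/
theorem relabel_annih (σ : ι ≃ κ) (i : ι) (v : Fock ι) :
    relabel σ (annih i v) = annih (σ i) (relabel σ v) := by
  let E := LinearMap.eqLocus ((relabel σ).toLinearMap ∘ₗ annih i)
    (annih (σ i) ∘ₗ (relabel σ).toLinearMap)
  suffices hE : E = ⊤ from (hE ▸ Submodule.mem_top : v ∈ E)
  refine eq_top_of_vac_mem E ?_ fun j w (hw : relabel σ (annih i w) = annih (σ i) _) => ?_
  · change relabel σ (annih i vac) = annih (σ i) (relabel σ vac)
    rw [annih_vac, map_zero, relabel_vac, annih_vac]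
  · change relabel σ (annih i (create j w)) = annih (σ i) (relabel σ (create j w))
    rw [annih_create_apply, map_sub, relabel_create, hw, relabel_create, annih_create_apply,
      apply_ite (relabel σ), map_zero]
    simp only [σ.apply_eq_iff_eq]
    rfl

theorem relabel_mode (σ : ι ≃ κ) (c : Prop) [Decidable c] (i : ι) (v : Fock ι) :
    relabel σ (mode c i v) = mode c (σ i) (relabel σ v) := by
  unfold mode
  split_ifs
  · exact relabel_create σ i v
  · exact relabel_annih σ i v

theorem relabel_rep (s : ℤ ≃ ι) (σ : ι ≃ κ) (x : DHat) (v : Fock ι) :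
    relabel σ ((fermionModes s).rep x v) = (fermionModes (s.trans σ)).rep x (relabel σ v) :=
  FermionModes.map_rep (fermionModes s) (fermionModes (s.trans σ)) (relabel σ).toLinearMap
    (fun i => relabel_mode σ (i < 0) (s i)) (fun i => relabel_mode σ (0 ≤ i) (s i)) x v

theorem exists_equiv_rep (s : ℤ ≃ ι) (t : ℤ ≃ κ) :
    ∃ e : Fock ι ≃ₗ[ℂ] Fock κ, ∀ x v,
      e ((fermionModes s).rep x v) = (fermionModes t).rep x (e v) := by
  refine ⟨relabel (s.symm.trans t), fun x v => ?_⟩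
  rw [relabel_rep, ← Equiv.trans_assoc, Equiv.self_trans_symm, Equiv.refl_trans]

end Fock

/-! ### Stable subspaces and charge -/

namespace FermionModes

variable {V : Type*} [AddCommGroup V] [Module ℂ V] (F : FermionModes V) {U : Submodule ℂ V}

/-- Lagrange interpolation at the finitely many `k` with `:ψ_{k+i-j} ψ*_k: v ≠ 0` isolates a
single term of a current. -/
theorem exists_rep_apply_eq_normalPair (i j : ℤ) (v : V) :
    ∃ x, F.rep x v = F.normalPair i j v := by
  let t := insert j (F.finite_normalPair (i - j) v).toFinset
  have hinj : Set.InjOn (fun k : ℤ => (k : ℂ)) t := Int.cast_injective.injOn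
  refine ⟨DHat.lift (hom (i - j) (Lagrange.basis t (fun k : ℤ => (k : ℂ)) j)), ?_⟩
  rw [rep_lift_hom, current_apply, finsum_eq_single _ j, evalInt_apply,
    Lagrange.eval_basis_self hinj (Finset.mem_insert_self _ _), one_smul, add_sub_cancel]
  intro k hk
  rw [evalInt_apply]
  by_cases hkt : k ∈ t
  · rw [Lagrange.eval_basis_of_ne hk.symm hkt, zero_smul]
  · have hzero : F.normalPair (k + (i - j)) k v = 0 := by
      by_contra hne
      exact hkt (Finset.mem_insert_of_mem ((Set.Finite.mem_toFinset _).2 hne))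
    rw [hzero, smul_zero]

theorem normalPair_mem_iff {i j : ℤ} {v : V} (hv : v ∈ U) :
    F.normalPair i j v ∈ U ↔ F.psi i (F.psiStar j v) ∈ U := by
  rw [normalPair_eq, LinearMap.sub_apply, LinearMap.smul_apply, Module.End.one_apply,
    Submodule.sub_mem_iff_left U (U.smul_mem _ hv), Module.End.mul_apply]

theorem forall_rep_mem_iff :
    (∀ x, ∀ v ∈ U, F.rep x v ∈ U) ↔ ∀ i j, ∀ v ∈ U, F.psi i (F.psiStar j v) ∈ U := by
  refine ⟨fun h i j v hv => ?_, fun h x v hv => ?_⟩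
  · obtain ⟨x, hx⟩ := F.exists_rep_apply_eq_normalPair i j v
    exact (F.normalPair_mem_iff hv).1 (hx ▸ h x v hv)
  · induction x using DHat.induction_hom with
    | hadd x y hx hy => exact map_add F.rep x y ▸ U.add_mem hx hy
    | hcentral c =>
      rw [map_smul, rep_central]
      exact U.smul_mem c hv
    | hhom r f =>
      rw [rep_lift_hom, current_apply]
      exact finsum_induction (· ∈ U) U.zero_mem (fun _ _ => U.add_mem) fun j =>
        U.smul_mem _ ((F.normalPair_mem_iff hv).2 (h _ j v hv))

end FermionModes

namespace Fock

section Charge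

variable {ι : Type*}

/-- The charge of a monomial, normalised so that the vacuum has charge zero and that `ψ_i` raises
the charge by one: a factor contributes `1` if its creation operator is one of the `ψ_i`, and `-1`
if it is one of the `ψ*_i`. -/
def charge (s : ℤ ≃ ι) (S : Finset ι) : ℤ := ∑ x ∈ S, if s.symm x < 0 then 1 else -1

theorem exists_charge_eq (s : ℤ ≃ ι) (m : ℤ) : ∃ S, charge s S = m := by
  rcases le_total 0 m with hm | hm
  · refine ⟨(Finset.Ico (-m) 0).map s.toEmbedding, ?_⟩
    rw [charge, Finset.sum_map, Finset.sum_congr rfl (g := fun _ => (1 : ℤ)) fun i hi => ?_]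
    · simp [hm]
    · simpa using (Finset.mem_Ico.1 hi).2
  · refine ⟨(Finset.Ico 0 (-m)).map s.toEmbedding, ?_⟩
    rw [charge, Finset.sum_map, Finset.sum_congr rfl (g := fun _ => (-1 : ℤ)) fun i hi => ?_]
    · simp [hm]
    · simpa using (Finset.mem_Ico.1 hi).1

variable [DecidableEq ι]

theorem symmDiff_singleton (S : Finset ι) (i : ι) :
    symmDiff S {i} = if i ∈ S then S.erase i else insert i S := by
  ext j
  split_ifs <;> simp only [Finset.mem_symmDiff, Finset.mem_singleton, Finset.mem_erase,
    Finset.mem_insert] <;> grind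

theorem charge_sub_charge (s : ℤ ≃ ι) (S T : Finset ι) :
    charge s T - charge s S = ∑ x ∈ symmDiff S T, if x ∈ S ↔ s.symm x < 0 then -1 else 1 := by
  rw [charge, charge, ← Finset.sum_sdiff_sub_sum_sdiff, symmDiff_def, Finset.sup_eq_union,
    Finset.sum_union (disjoint_sdiff_sdiff), sub_eq_neg_add, ← Finset.sum_neg_distrib]
  congr 1 <;> refine Finset.sum_congr rfl fun x hx => ?_ <;> rw [Finset.mem_sdiff] at hx
  · simp only [hx.1, true_iff]
    split_ifs <;> rfl
  · simp only [hx.2, false_iff]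
    split_ifs <;> rfl

theorem charge_symmDiff_singleton (s : ℤ ≃ ι) (S : Finset ι) (i : ℤ) :
    charge s (symmDiff S {s i}) = charge s S + if s i ∈ S ↔ i < 0 then -1 else 1 := by
  rw [← sub_eq_iff_eq_add', charge_sub_charge, symmDiff_symmDiff_cancel_left,
    Finset.sum_singleton, s.symm_apply_apply]

theorem exists_raising_mem_symmDiff {s : ℤ ≃ ι} {S T : Finset ι} (hST : S ≠ T)
    (h : charge s S = charge s T) : ∃ i, s i ∈ symmDiff S T ∧ ¬(s i ∈ S ↔ i < 0) := by
  by_contra! hlower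
  have hsum := charge_sub_charge s S T
  rw [h, sub_self, Finset.sum_congr rfl (g := fun _ => (-1 : ℤ)) fun x hx => if_pos (by
    simpa using hlower (s.symm x) (by simpa using hx))] at hsum
  have : (symmDiff S T).card = 0 := by simpa using hsum
  exact hST (symmDiff_eq_bot.1 (Finset.card_eq_zero.1 this))

end Charge

variable {ι : Type}

/-- The subspace of the vectors of charge `m`. -/
def chargeSpace (s : ℤ ≃ ι) (m : ℤ) : Submodule ℂ (Fock ι) :=
  Finsupp.supported ℂ ℂ {S | charge s S = m}

theorem mono_mem_chargeSpace {s : ℤ ≃ ι} {S : Finset ι} {m : ℤ} (hS : charge s S = m) :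
    mono S ∈ chargeSpace s m :=
  Finsupp.single_mem_supported ℂ _ hS

theorem chargeSpace_le_iff {s : ℤ ≃ ι} {m : ℤ} {U : Submodule ℂ (Fock ι)} :
    chargeSpace s m ≤ U ↔ ∀ S, charge s S = m → mono S ∈ U := by
  rw [chargeSpace, Finsupp.supported_eq_span_single, Submodule.span_le, Set.image_subset_iff]
  rfl

variable [LinearOrder ι]

theorem mode_mono (c : Prop) [Decidable c] (i : ι) (S : Finset ι) :
    mode c i (mono S) = if i ∈ S ↔ c then 0 else sgn S i • mono (symmDiff S {i}) := by
  rw [symmDiff_singleton]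
  by_cases hc : c <;> by_cases hi : i ∈ S <;> simp [mode, create_mono, annih_mono, hc, hi]

theorem sgn_ne_zero (S : Finset ι) (i : ι) : sgn S i ≠ 0 :=
  left_ne_zero_of_mul_eq_one (sgn_mul_self S i)

theorem psi_mono (s : ℤ ≃ ι) (i : ℤ) (S : Finset ι) :
    (fermionModes s).psi i (mono S)
      = if s i ∈ S ↔ i < 0 then 0 else sgn S (s i) • mono (symmDiff S {s i}) :=
  mode_mono _ _ _

theorem psiStar_mono (s : ℤ ≃ ι) (i : ℤ) (S : Finset ι) :
    (fermionModes s).psiStar i (mono S)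
      = if s i ∈ S ↔ i < 0 then sgn S (s i) • mono (symmDiff S {s i}) else 0 := by
  refine (mode_mono _ _ _).trans ?_
  rw [← ite_not]
  exact if_congr (by lia) rfl rfl

theorem psi_psiStar_self_apply (s : ℤ ≃ ι) (i : ℤ) (v : Fock ι) :
    (fermionModes s).psi i ((fermionModes s).psiStar i v)
      = v.filter fun S => s i ∈ S ↔ i < 0 := by
  induction v using Finsupp.induction_linear with
  | zero => rw [map_zero, map_zero, Finsupp.filter_zero]
  | add v w hv hw => rw [map_add, map_add, hv, hw, Finsupp.filter_add]
  | single S c =>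
    have hi : s i ∈ symmDiff S {s i} ↔ s i ∉ S := by simp [Finset.mem_symmDiff]
    have hsgn : sgn S (s i) * sgn (symmDiff S {s i}) (s i) = 1 := by
      rw [symmDiff_singleton]
      split_ifs with h
      · rw [sgn_erase h, if_neg (lt_irrefl _), one_mul, sgn_mul_self]
      · rw [sgn_insert h, if_neg (lt_irrefl _), one_mul, sgn_mul_self]
    have hc : Finsupp.single S c = c • mono S := by simp [mono]
    by_cases h : s i ∈ S ↔ i < 0
    · rw [Finsupp.filter_single_of_pos (fun S => s i ∈ S ↔ i < 0) h, hc, map_smul, map_smul,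
        psiStar_mono, if_pos h, map_smul, psi_mono, if_neg (by tauto), smul_smul, smul_smul,
        mul_assoc, hsgn, mul_one, symmDiff_symmDiff_cancel_right]
    · rw [Finsupp.filter_single_of_neg (fun S => s i ∈ S ↔ i < 0) h, hc, map_smul, map_smul,
        psiStar_mono, if_neg h, map_zero, smul_zero]

variable {s : ℤ ≃ ι} {U : Submodule ℂ (Fock ι)}

theorem filter_mem (hU : ∀ x, ∀ v ∈ U, (fermionModes s).rep x v ∈ U) (i : ι) (T : Finset ι)
    {v : Fock ι} (hv : v ∈ U) : v.filter (fun S => i ∈ S ↔ i ∈ T) ∈ U := by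
  obtain ⟨i, rfl⟩ := s.surjective i
  have h := (FermionModes.forall_rep_mem_iff _).1 hU i i v hv
  rw [psi_psiStar_self_apply] at h
  have hfilter : v.filter (fun S => s i ∈ S ↔ s i ∈ T) = if s i ∈ T ↔ i < 0
      then v.filter fun S => s i ∈ S ↔ i < 0 else v - v.filter fun S => s i ∈ S ↔ i < 0 := by
    ext S
    split_ifs <;> simp only [Finsupp.sub_apply, Finsupp.filter_apply] <;> grind
  rw [hfilter]
  split_ifs
  exacts [h, U.sub_mem hv h]

/-- The number operators separate the monomials. -/
theorem mono_mem_of_apply_ne_zero (hU : ∀ x, ∀ v ∈ U, (fermionModes s).rep x v ∈ U)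
    {v : Fock ι} (hv : v ∈ U) {T : Finset ι} (hT : v T ≠ 0) : mono T ∈ U := by
  have hfilter (A : Finset ι) : v.filter (fun S => ∀ i ∈ A, (i ∈ S ↔ i ∈ T)) ∈ U := by
    induction A using Finset.induction_on with
    | empty =>
      convert hv
      exact (Finsupp.filter_eq_self_iff _ _).2 fun _ _ => by simp
    | insert i A _ ih =>
      convert filter_mem hU i T ih using 1
      ext S
      simp only [Finsupp.filter_apply, Finset.forall_mem_insert]
      grind
  have hsingle : v.filter (fun S => ∀ i ∈ T ∪ v.support.biUnion id, (i ∈ S ↔ i ∈ T))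
      = v T • mono T := by
    ext S
    rw [Finsupp.filter_apply, mono, Finsupp.smul_single, smul_eq_mul, mul_one,
      Finsupp.single_apply]
    by_cases hTS : T = S
    · subst hTS
      simp
    · rw [if_neg hTS, ite_eq_right_iff]
      refine fun hagree => by_contra fun hS => hTS (Finset.ext fun i => ⟨fun hi => ?_, ?_⟩)
      · exact (hagree i (Finset.mem_union_left _ hi)).2 hi
      · exact fun hi => (hagree i (Finset.mem_union_right _ (Finset.mem_biUnion.2
          ⟨S, Finsupp.mem_support_iff.2 hS, hi⟩))).1 hi
  rw [← U.smul_mem_iff hT, ← hsingle]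
  exact hfilter _

/-- The infinite general linear algebra moves a particle from any occupied mode to any free one,
and so connects all monomials of the same charge. -/
theorem mono_mem_of_charge_eq (hU : ∀ x, ∀ v ∈ U, (fermionModes s).rep x v ∈ U)
    {S T : Finset ι} (hS : mono S ∈ U) (h : charge s S = charge s T) : mono T ∈ U := by
  induction hn : (symmDiff S T).card using Nat.strong_induction_on generalizing S with
  | _ n ih =>
    obtain rfl | hST := eq_or_ne S T
    · exact hS
    obtain ⟨i, hiST, hiS⟩ := exists_raising_mem_symmDiff hST h
    obtain ⟨j, hjST, hjT⟩ := exists_raising_mem_symmDiff hST.symm h.symm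
    let R := symmDiff (symmDiff S {s j}) {s i}
    have hjS : s j ∈ S ↔ j < 0 := by
      rw [Finset.mem_symmDiff] at hjST
      tauto
    have hij : s i ≠ s j := fun hij => hiS (s.injective hij ▸ hjS)
    have hiS' : ¬(s i ∈ symmDiff S {s j} ↔ i < 0) := by
      simpa [Finset.mem_symmDiff, hij] using hiS
    have hR : mono R ∈ U := by
      have hmove := (FermionModes.forall_rep_mem_iff _).1 hU i j _ hS
      rwa [psiStar_mono, if_pos hjS, map_smul, psi_mono, if_neg hiS',
        U.smul_mem_iff (sgn_ne_zero _ _), U.smul_mem_iff (sgn_ne_zero _ _)] at hmove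
    have hcharge : charge s R = charge s T := by
      rw [charge_symmDiff_singleton, if_neg hiS', charge_symmDiff_singleton, if_pos hjS, ← h]
      ring
    have hcloser : symmDiff R T ⊂ symmDiff S T := by
      refine Finset.ssubset_iff_of_subset (fun k hk => ?_) |>.2 ⟨s i, hiST, ?_⟩
      · simp only [R, Finset.mem_symmDiff, Finset.mem_singleton] at hk hiST hjST ⊢
        grind
      · simp only [R, Finset.mem_symmDiff, Finset.mem_singleton] at hiST ⊢
        grind
    exact ih _ (hn ▸ Finset.card_lt_card hcloser) hR hcharge rfl

theorem psi_mem_chargeSpace {m : ℤ} {v : Fock ι} (hv : v ∈ chargeSpace s m) (i : ℤ) :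
    (fermionModes s).psi i v ∈ chargeSpace s (m + 1) := by
  refine chargeSpace_le_iff (U := (chargeSpace s (m + 1)).comap _).2 (fun S hS => ?_) hv
  rw [Submodule.mem_comap, psi_mono]
  split_ifs with h
  · exact Submodule.zero_mem _
  · exact Submodule.smul_mem _ _ (mono_mem_chargeSpace (by
      rw [charge_symmDiff_singleton, if_neg h, hS]))

theorem psiStar_mem_chargeSpace {m : ℤ} {v : Fock ι} (hv : v ∈ chargeSpace s m) (i : ℤ) :
    (fermionModes s).psiStar i v ∈ chargeSpace s (m - 1) := by
  refine chargeSpace_le_iff (U := (chargeSpace s (m - 1)).comap _).2 (fun S hS => ?_) hv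
  rw [Submodule.mem_comap, psiStar_mono]
  split_ifs with h
  · exact Submodule.smul_mem _ _ (mono_mem_chargeSpace (by
      rw [charge_symmDiff_singleton, if_pos h, hS, sub_eq_add_neg]))
  · exact Submodule.zero_mem _

theorem isIrreducibleOn_chargeSpace (s : ℤ ≃ ι) (m : ℤ) :
    IsIrreducibleOn (fermionModes s).rep (chargeSpace s m) := by
  refine ⟨(FermionModes.forall_rep_mem_iff _).2 fun i j v hv => ?_, ?_, fun U hUm hU => ?_⟩
  · exact sub_add_cancel m 1 ▸ psi_mem_chargeSpace (psiStar_mem_chargeSpace hv j) i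
  · obtain ⟨S, hS⟩ := exists_charge_eq s m
    exact (Submodule.ne_bot_iff _).2 ⟨_, mono_mem_chargeSpace hS, by simp [mono]⟩
  · refine or_iff_not_imp_left.2 fun hU0 => le_antisymm hUm (chargeSpace_le_iff.2 fun T hT => ?_)
    obtain ⟨v, hv, hv0⟩ := (Submodule.ne_bot_iff U).1 hU0
    obtain ⟨S, hS⟩ := Finsupp.ne_iff.1 hv0
    refine mono_mem_of_charge_eq hU (mono_mem_of_apply_ne_zero hU hv hS) ?_
    exact (hUm hv (Finsupp.mem_support_iff.2 hS)).trans hT.symm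

end Fock

theorem isInternal_supported_fiber (R : Type*) {M α κ : Type*} [Ring R] [AddCommGroup M]
    [Module R M] [DecidableEq κ] (d : α → κ) :
    DirectSum.IsInternal fun m => Finsupp.supported M R (d ⁻¹' {m}) := by
  rw [DirectSum.isInternal_submodule_iff_iSupIndep_and_iSup_eq_top]
  refine ⟨fun m => ?_, ?_⟩
  · have hdisj : Disjoint (d ⁻¹' {m}) {a | d a ≠ m} :=
      Set.disjoint_left.2 fun _ ha hne => hne ha
    refine (Finsupp.disjoint_supported_supported hdisj).mono_right (iSup₂_le fun n hn => ?_)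
    exact Finsupp.supported_mono fun _ ha => ne_of_eq_of_ne ha hn
  · rw [← Finsupp.supported_iUnion, ← Set.preimage_iUnion, Set.iUnion_of_singleton,
      Set.preimage_univ, Finsupp.supported_univ]

theorem odd_intEquivNat (i : ℤ) : Odd (Equiv.intEquivNat i) ↔ i < 0 := by
  by_cases hi : i < 0
  · rw [intEquivNat_of_neg hi, Nat.odd_iff]
    lia
  · rw [intEquivNat_of_nonneg (by lia), Nat.odd_iff]
    lia

theorem dg_eq_charge (S : Finset ℕ) : dg S = charge Equiv.intEquivNat S := by
  have hodd (n : ℕ) : Equiv.intEquivNat.symm n < 0 ↔ Odd n := by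
    rw [← odd_intEquivNat, Equiv.apply_symm_apply]
  simp only [charge, hodd, Finset.sum_ite, Nat.not_odd_iff_even]
  simp [dg, sub_eq_add_neg]

theorem component_eq_chargeSpace (m : ℤ) : component m = chargeSpace Equiv.intEquivNat m := by
  simp only [component, dg_eq_charge]
  exact (Finsupp.supported_eq_span_single ℂ _).symm

theorem isIrreducibleOn_component (m : ℤ) : IsIrreducibleOn neutralModes.rep (component m) :=
  component_eq_chargeSpace m ▸ isIrreducibleOn_chargeSpace _ m

theorem isInternal_component : DirectSum.IsInternal component := by
  rw [funext component_eq_chargeSpace]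
  exact isInternal_supported_fiber ℂ (charge Equiv.intEquivNat)

end

theorem mainTheorem7 :
    ∃ ρ : DHat →ₗ⁅ℂ⁆ Module.End ℂ FockD,
      -- the assignment of fields `∑ J^k_n z ^ (-2k-2n-2) ↦ currentD k` is an action
      (∀ (k : ℕ) (n : ℤ),
        ρ (DHat.J k n) = HVertexOperator.coeff (currentD k) (-2 * (k : ℤ) - 2 * n - 2)) ∧
      (∀ (k : ℕ) (m : ℤ), Odd m → HVertexOperator.coeff (currentD k) m = 0) ∧
      -- the action is determined by the assignment, and the central element acts as the identity
      (∀ ρ' : DHat →ₗ⁅ℂ⁆ Module.End ℂ FockD,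
        (∀ (k : ℕ) (n : ℤ),
          ρ' (DHat.J k n) = HVertexOperator.coeff (currentD k) (-2 * (k : ℤ) - 2 * n - 2)) →
        ρ' = ρ) ∧
      ρ DHat.central = 1 ∧
      -- the decomposition into irreducible submodules
      DirectSum.IsInternal component ∧
      (∀ m : ℤ, IsIrreducibleOn ρ (component m)) ∧
      -- the isomorphism with the Fock space of a pair of charged fermions
      ∃ ρA : DHat →ₗ⁅ℂ⁆ Module.End ℂ FockA,
        (∀ (k : ℕ) (n : ℤ),
          ρA (DHat.J k n) = HVertexOperator.coeff (currentA k) (-(k : ℤ) - n - 1)) ∧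
        ∃ e : FockA ≃ₗ[ℂ] FockD, ∀ (x : DHat) (v : FockA), e (ρA x v) = ρ x (e v) := by
  obtain ⟨e, he⟩ := Fock.exists_equiv_rep (Equiv.subLeft (-1)) Equiv.intEquivNat
  exact ⟨neutralModes.rep, rep_neutralModes_J, fun k m hm => coeff_currentD_odd k hm,
    fun ρ' h => DHat.hom_ext fun k n => (h k n).trans (rep_neutralModes_J k n).symm,
    neutralModes.rep_central, isInternal_component, isIrreducibleOn_component,
    chargedModes.rep, rep_chargedModes_J, e, he⟩
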